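/- Let $k$ be an algebraically closed field of characteristic $2$, let $W(k)$ be its ring of Witt vectors and $K_0=\mathrm{Frac}(W(k))$. For $c\ge 1$ let $K_c=K_0(\zeta_{2^c})$, where $\zeta_{2^c}$ is a primitive $2^c$-th root of unity; in particular $K_1=K_0$. For a finite Galois extension $L/K_0$ with group $G$ and normalized valuation $v_L$, let $G_i=\{g\in G: v_L(g\pi_L-\pi_L)\ge i+1\}$ ($i\in\mathbb R_{\ge 0}$, $\pi_L$ a uniformizer of $L$) be the ramification groups in the lower numbering, let $G^i=G_{\psi(i)}$ be those in the upper numbering, where $\psi$ is the inverse of $\varphi(u)=\int_0^u \frac{dt}{[G_0:G_t]}$ on $[0,\infty)$, and define the conductor by $h_{L/K_0}=\sup\{i\ge 0: G^i\ne\{\mathrm{id}\}\}$. Let $c\ge 1$ and $0\le n<2^c$ be integers, let $b\in W(k)$ with $b\equiv 1\pmod 2$, put $a=2^nb\in K_0=K_1$ and $K=K_c(\sqrt[2^c]{a})$. Then $K/K_1$ is a finite Galois extension, and the following hold. (i) If $n$ is odd, then $h_{K/K_1}=c+1$. (ii) Suppose $n$ is even. (a) If $c=1$ and $b\equiv 1\pmod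 4$, then $K=K_1$. (b) If $c=1$ and $b\equiv 3\pmod 4$, then $h_{K/K_1}=1$. (c) If $4\mid n$, $c>1$ and $b\equiv 1\pmod 4$, then $h_{K/K_1}=c-1$. (d) If $4\mid n$, $c>1$ and $b\equiv 3\pmod 4$, then $h_{K/K_1}=c$. (e) If $4\nmid n$, $c>1$ and $b\equiv 1\pmod 4$, then $h_{K/K_1}=c$. (f) If $4\nmid n$, $c=2$ and $b\equiv 3\pmod 4$, then $h_{K/K_1}=1$. (g) If $4\nmid n$, $c>2$ and $b\equiv 3\pmod 4$, then $h_{K/K_1}=c-\tfrac12$. Here congruences are taken in $W(k)$. -/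

import Mathlib

noncomputable section

namespace Ramification

/-! Throughout this namespace `A` is (in the intended use) a complete discrete valuation ring with
fraction field `K`, and `L / K` is a finite Galois extension with group `Gal(L/K)`.  The valuation
ring `𝒪_L` of `L` is the integral closure of `A` in `L`; it is again a discrete valuation ring. -/

section

variable (A K L : Type*) [CommRing A] [Field K] [Field L] [Algebra A K] [Algebra K L] [Algebra A L]
  [IsScalarTower A K L]

/-- The maximal ideal of the (local) valuation ring `𝒪_L`, i.e. its Jacobson radical.  For the
normalized valuation `v_L` and `x` in `𝒪_L`, one has `v_L x ≥ m` iff `x ∈ maxIdeal A L ^ m`. -/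
def maxIdeal : Ideal (integralClosure A L) := Ideal.jacobson ⊥

/-- The lower numbering ramification group `G_i`, for real `i ≥ 0`: those `g` with
`v_L (g π - π) ≥ i + 1` for the uniformizers `π` (the irreducible elements of `𝒪_L`).  As `v_L`
takes integer values, `v_L ≥ i + 1` means `v_L ≥ ⌈i⌉ + 1`. -/
def lowerGroup (i : ℝ) : Subgroup Gal(L/K) where
  carrier := {g | ∀ π : integralClosure A L, Irreducible π → g • π - π ∈ maxIdeal A L ^ (⌈i⌉₊ + 1)}
  one_mem' := by
    intro π _
    simp
  mul_mem' := by
    intro g h hg hh π hπ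
    have h1 := hg (h • π) ((MulEquiv.irreducible_iff
      (MulSemiringAction.toRingEquiv Gal(L/K) (integralClosure A L) h)).mpr hπ)
    have h2 := hh π hπ
    have h3 := add_mem h1 h2
    rwa [sub_add_sub_cancel, ← mul_smul] at h3
  inv_mem' := by
    intro g hg π hπ
    have h1 := hg (g⁻¹ • π) ((MulEquiv.irreducible_iff
      (MulSemiringAction.toRingEquiv Gal(L/K) (integralClosure A L) g⁻¹)).mpr hπ)
    rw [smul_inv_smul] at h1
    rw [← neg_mem_iff, neg_sub]
    exact h1

/-- The Herbrand function `φ_{L/K}(u) = ∫_0^u dt / [G_0 : G_t]`, a strictly increasing bijection of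
`[0, ∞)` onto itself. -/
def phi (u : ℝ) : ℝ :=
  ∫ t in (0 : ℝ)..u, (Nat.card (lowerGroup A K L t) : ℝ) / Nat.card (lowerGroup A K L 0)

/-- `ψ_{L/K} : [0, ∞) → [0, ∞)`, the inverse of `φ_{L/K}`. -/
def psi : ℝ → ℝ := Function.invFunOn (phi A K L) (Set.Ici 0)

/-- The upper numbering ramification group `G^i = G_{ψ(i)}`, for real `i ≥ 0`. -/
def upperGroup (i : ℝ) : Subgroup Gal(L/K) := lowerGroup A K L (psi A K L i)

/-- The conductor `h_{L/K}`: the supremum of the `i ≥ 0` with `G^i` nontrivial (so `0` if `L = K`). -/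
def conductor : ℝ := sSup {i : ℝ | 0 ≤ i ∧ upperGroup A K L i ≠ ⊥}

end

/-- `K_0 = Frac (W(k))` for `k` of characteristic `2`; it equals `K_1 = K_0(ζ_2)` as `ζ_2 = -1`. -/
abbrev WittField (k : Type*) [Field k] [CharP k 2] : Type _ := FractionRing (WittVector 2 k)

end Ramification

end

/-!
Everything is computed inside `Ω`, with a Galois invariant valuation `v`. For a totally ramified
`L / K` with uniformizer `x`, the function `r ↦ ∏ max (v (z - x)) r` over the conjugates `z` of `x`
is a multiplicative form of the Herbrand function `φ`, so that the upper ramification breaks are its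
values at the distances `v (z - x)`, and Herbrand's theorem makes the bounds "all breaks are at most
`h`" and "some break is at least `h`" compatible with composites and subfields.

* Upper bounds follow Fontaine: the breaks of `L / K` are at most `h` if every element of `Ω` at
  which the minimal polynomial of `x` is small enough is close to an actual conjugate of `x`. For
  Kummer extensions such elements are roots of the defining radical equation modulo a power of `2`,
  and these are corrected by extracting `2`-power roots of elements near `1`.
* Lower bounds come from explicit Eisenstein polynomials: the value of the derivative at `x`, or
  the distance between two explicit conjugates, exhibits a large break.

The field `K(ζ, α)` is then compared with the composite of a cyclotomic field and the field of a
simpler radical: when all breaks of one factor are smaller, it does not affect the conductor.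
In case (g) the break `c - 1 / 2` is that of the `2 ^ (c - 2)`-th roots of `1 + i`,
as `-4 = (1 + i) ^ 4`.
-/

namespace Ramification

open Polynomial NNReal IsLocalRing IntermediateField

/-! ### Conjugates and Galois invariant valuations -/

section Conjugates

variable (K : Type*) {Ω : Type*} [Field K] [Field Ω] [Algebra K Ω]

open Classical in
/-- The finite set of conjugates of `x` over `K` in `Ω`. -/
noncomputable def conj (x : Ω) : Finset Ω := ((minpoly K x).aroots Ω).toFinset

variable [IsGalois K Ω] {x z : Ω}

lemma mem_conj_iff : z ∈ conj K x ↔ ∃ σ : Gal(Ω/K), σ x = z := by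
  classical
  rw [conj, Multiset.mem_toFinset, mem_aroots,
    and_iff_right (minpoly.ne_zero (Algebra.IsIntegral.isIntegral x))]
  constructor
  · exact minpoly.exists_algEquiv_of_root' (Algebra.IsAlgebraic.isAlgebraic x)
  · rintro ⟨σ, rfl⟩
    simp [aeval_algHom_apply]

lemma self_mem_conj (x : Ω) : x ∈ conj K x := (mem_conj_iff K).mpr ⟨1, rfl⟩

lemma apply_mem_conj (σ : Gal(Ω/K)) (hz : z ∈ conj K x) : σ z ∈ conj K x := by
  obtain ⟨τ, rfl⟩ := (mem_conj_iff K).mp hz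
  exact (mem_conj_iff K).mpr ⟨σ * τ, rfl⟩

lemma map_minpoly_eq_prod_conj (x : Ω) :
    (minpoly K x).map (algebraMap K Ω) = ∏ z ∈ conj K x, (X - C z) := by
  classical
  have hs : (minpoly K x).Separable := Algebra.IsSeparable.isSeparable K x
  rw [(Normal.splits inferInstance x).eq_prod_roots_of_monic
      ((minpoly.monic (Algebra.IsIntegral.isIntegral x)).map _),
    Finset.prod, conj, Multiset.toFinset_val, Multiset.dedup_eq_self.mpr (nodup_roots hs.map)]

lemma aeval_minpoly_eq_prod_conj (x β : Ω) :
    aeval β (minpoly K x) = ∏ z ∈ conj K x, (β - z) := by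
  rw [← eval_map_algebraMap, map_minpoly_eq_prod_conj, eval_prod]
  simp

lemma card_conj (x : Ω) : (conj K x).card = (minpoly K x).natDegree := by
  rw [← natDegree_map (algebraMap K Ω), map_minpoly_eq_prod_conj,
    natDegree_prod_of_monic _ _ fun z _ ↦ monic_X_sub_C z]
  simp

open Classical in
lemma aeval_derivative_minpoly_eq_prod_conj (x : Ω) :
    aeval x (derivative (minpoly K x)) = ∏ z ∈ (conj K x).erase x, (x - z) := by
  rw [← eval_map_algebraMap, ← derivative_map, map_minpoly_eq_prod_conj,
    ← Finset.mul_prod_erase _ _ (self_mem_conj K x), derivative_mul]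
  simp [eval_prod]

end Conjugates

/-- A Galois invariant valuation on an extension `Ω` of `K` whose restriction to `K` is discrete
with valuation ring `A`. It is normalized by giving the uniformizers of `A` the value `1 / 2`, so
that a normalized additive valuation `m` corresponds to the value `2 ^ (-m)`. -/
structure IsNormalized (A K : Type*) {Ω : Type*} [CommRing A] [Field K] [Field Ω] [Algebra A K]
    [Algebra K Ω] (v : Valuation Ω ℝ≥0) : Prop where
  map_algEquiv (σ : Gal(Ω/K)) (x : Ω) : v (σ x) = v x
  integers : (v.comap (algebraMap K Ω)).Integers A
  map_irreducible {ϖ : A} : Irreducible ϖ → v (algebraMap K Ω (algebraMap A K ϖ)) = 2⁻¹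

lemma map_coeff_prod_X_sub_C_le_one {F Γ : Type*} [Field F] [LinearOrderedCommGroupWithZero Γ]
    (v : Valuation F Γ) {s : Finset F} (hs : ∀ z ∈ s, v z ≤ 1) (i : ℕ) :
    v ((∏ z ∈ s, (X - C z)).coeff i) ≤ 1 := by
  have hmem : ∏ z ∈ s, (X - C z) ∈ lifts v.integer.subtype :=
    prod_mem fun z hz ↦ ⟨X - C ⟨z, hs z hz⟩, by simp⟩
  obtain ⟨a, ha⟩ := (lifts_iff_coeff_lifts _).mp hmem i
  exact ha ▸ a.2

namespace IsNormalized

variable {A K Ω : Type*} [CommRing A] [Field K] [Field Ω] [Algebra A K] [Algebra K Ω]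
  {v : Valuation Ω ℝ≥0}

lemma map_conj [IsGalois K Ω] (hv : IsNormalized A K v) {x z : Ω} (hz : z ∈ conj K x) :
    v z = v x := by
  obtain ⟨σ, rfl⟩ := (mem_conj_iff K).mp hz
  exact hv.map_algEquiv σ x

lemma map_pow_natDegree [IsGalois K Ω] (hv : IsNormalized A K v) (x : Ω) :
    v x ^ (minpoly K x).natDegree = v (algebraMap K Ω ((minpoly K x).coeff 0)) := by
  rw [← coeff_map, map_minpoly_eq_prod_conj, coeff_zero_eq_eval_zero, eval_prod, map_prod,
    ← card_conj, ← Finset.prod_const]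
  refine Finset.prod_congr rfl fun z hz ↦ ?_
  simp [hv.map_conj hz]

lemma exists_map_eq_minpoly [IsGalois K Ω] (hv : IsNormalized A K v) {x : Ω} (hx : v x ≤ 1) :
    ∃ P : A[X], P.Monic ∧ P.map (algebraMap A K) = minpoly K x := by
  have hlift : minpoly K x ∈ lifts (algebraMap A K) := by
    refine (lifts_iff_coeff_lifts _).mpr fun i ↦ hv.integers.exists_of_le_one ?_
    rw [Valuation.comap_apply, ← coeff_map, map_minpoly_eq_prod_conj]
    exact map_coeff_prod_X_sub_C_le_one v (fun z hz ↦ (hv.map_conj hz).trans_le hx) i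
  obtain ⟨P, hP, -, hmonic⟩ := lifts_and_degree_eq_and_monic hlift
    (minpoly.monic (Algebra.IsIntegral.isIntegral x))
  exact ⟨P, hmonic, hP⟩

section DiscreteValuationRing

variable [IsDomain A] [IsDiscreteValuationRing A]

lemma exists_map_eq_zpow (hv : IsNormalized A K v) {x : K} (hx : x ≠ 0) :
    ∃ n : ℤ, v (algebraMap K Ω x) = 2 ^ n := by
  obtain ⟨ϖ, hϖ⟩ := IsDiscreteValuationRing.exists_irreducible A
  have hpow (a : A) (ha : algebraMap A K a ≠ 0) :
      ∃ n : ℕ, v (algebraMap K Ω (algebraMap A K a)) = 2⁻¹ ^ n := by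
    obtain ⟨n, u, rfl⟩ := IsDiscreteValuationRing.eq_unit_mul_pow_irreducible
      (x := a) (by rintro rfl; simp at ha) hϖ
    refine ⟨n, ?_⟩
    have hu : v (algebraMap K Ω (algebraMap A K u)) = 1 := hv.integers.valuation_unit u
    rw [map_mul, map_mul, map_mul, hu, one_mul, map_pow, map_pow, map_pow, hv.map_irreducible hϖ]
  obtain ⟨a, rfl | ha⟩ := hv.integers.eq_algebraMap_or_inv_eq_algebraMap x
  · obtain ⟨n, hn⟩ := hpow a hx
    exact ⟨-n, by simp [hn]⟩
  · obtain ⟨n, hn⟩ := hpow a (ha ▸ inv_ne_zero hx)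
    refine ⟨n, ?_⟩
    rw [← ha, map_inv₀, map_inv₀, inv_pow] at hn
    simpa using hn

lemma exists_map_pow_finrank_eq [IsGalois K Ω] (hv : IsNormalized A K v)
    (L : IntermediateField K Ω) {x : Ω} (hx : x ∈ L) (hx0 : x ≠ 0) :
    ∃ n : ℤ, v x ^ Module.finrank K L = 2 ^ n := by
  obtain ⟨m, hm⟩ : (minpoly K x).natDegree ∣ Module.finrank K L := by
    have := minpoly.degree_dvd (K := K) (x := (⟨x, hx⟩ : L)) (Algebra.IsIntegral.isIntegral _)
    rwa [← minpoly.algebraMap_eq (algebraMap L Ω).injective] at this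
  obtain ⟨n, hn⟩ := hv.exists_map_eq_zpow
    (minpoly.coeff_zero_ne_zero (Algebra.IsIntegral.isIntegral x) hx0)
  refine ⟨n * m, ?_⟩
  rw [hm, pow_mul, hv.map_pow_natDegree, hn, zpow_mul, zpow_natCast]

end DiscreteValuationRing

section Integrality

variable [Algebra A Ω] [IsScalarTower A K Ω]

lemma map_algebraMap_le_one (hv : IsNormalized A K v) (a : A) : v (algebraMap A Ω a) ≤ 1 := by
  rw [IsScalarTower.algebraMap_apply A K Ω]
  exact hv.integers.map_le_one a

lemma map_algebraMap_irreducible (hv : IsNormalized A K v) {ϖ : A} (hϖ : Irreducible ϖ) :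
    v (algebraMap A Ω ϖ) = 2⁻¹ := by
  rw [IsScalarTower.algebraMap_apply A K Ω, hv.map_irreducible hϖ]

lemma algebraMap_irreducible_ne_zero (hv : IsNormalized A K v) {ϖ : A} (hϖ : Irreducible ϖ) :
    algebraMap A Ω ϖ ≠ 0 :=
  v.ne_zero_iff.mp (hv.map_algebraMap_irreducible hϖ ▸ by simp)

lemma map_aeval_le_one (hv : IsNormalized A K v) (g : A[X]) {x : Ω} (hx : v x ≤ 1) :
    v (aeval x g) ≤ 1 := by
  rw [aeval_eq_sum_range]
  refine v.map_sum_le fun i _ ↦ ?_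
  rw [Algebra.smul_def, map_mul, map_pow]
  exact mul_le_one' (hv.map_algebraMap_le_one _) (pow_le_one' hx _)

lemma map_aeval_sub_aeval_le (hv : IsNormalized A K v) (g : A[X]) {x y : Ω} (hx : v x ≤ 1)
    (hy : v y ≤ 1) : v (aeval x g - aeval y g) ≤ v (x - y) := by
  rw [aeval_eq_sum_range, aeval_eq_sum_range, ← Finset.sum_sub_distrib]
  refine v.map_sum_le fun i _ ↦ ?_
  rw [← smul_sub, Algebra.smul_def, map_mul]
  refine (mul_le_of_le_one_left' (hv.map_algebraMap_le_one _)).trans ?_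
  rw [← geom_sum₂_mul, map_mul]
  refine mul_le_of_le_one_left' (v.map_sum_le fun j _ ↦ ?_)
  rw [map_mul, map_pow, map_pow]
  exact mul_le_one' (pow_le_one' hx _) (pow_le_one' hy _)

lemma isIntegral_iff [IsGalois K Ω] (hv : IsNormalized A K v) {x : Ω} :
    IsIntegral A x ↔ v x ≤ 1 := by
  constructor
  · intro hx
    let f : A →+* v.integer :=
      (algebraMap A Ω).codRestrict v.integer fun a ↦ hv.map_algebraMap_le_one a
    exact (Valuation.mem_integer_iff _ _).mp <| (Valuation.integer.integers v).mem_of_integral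
      (RingHom.IsIntegralElem.of_comp (f := f) (g := algebraMap v.integer Ω) hx)
  · intro hx
    obtain ⟨P, hP, hPx⟩ := hv.exists_map_eq_minpoly hx
    refine ⟨P, hP, ?_⟩
    rw [← aeval_def, ← aeval_map_algebraMap K, hPx, minpoly.aeval]

lemma map_algebraMap_eq_one_iff (hv : IsNormalized A K v) {a : A} :
    v (algebraMap A Ω a) = 1 ↔ IsUnit a := by
  rw [hv.integers.isUnit_iff_valuation_eq_one, Valuation.comap_apply,
    ← IsScalarTower.algebraMap_apply]

lemma map_algebraMap_lt_one_iff [IsLocalRing A] (hv : IsNormalized A K v) {a : A} :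
    v (algebraMap A Ω a) < 1 ↔ a ∈ maximalIdeal A := by
  rw [mem_maximalIdeal, mem_nonunits_iff, ← hv.map_algebraMap_eq_one_iff,
    (hv.map_algebraMap_le_one a).lt_iff_ne]

lemma exists_map_sub_lt_one [IsLocalRing A] [IsAlgClosed (ResidueField A)] [IsGalois K Ω]
    (hv : IsNormalized A K v) {x : Ω} (hx : v x ≤ 1) : ∃ a : A, v (x - algebraMap A Ω a) < 1 := by
  obtain ⟨P, hP, hPx⟩ := hv.exists_map_eq_minpoly hx
  have hdeg : P.degree ≠ 0 := by
    rw [← hP.degree_map (algebraMap A K), hPx]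
    exact (minpoly.degree_pos (Algebra.IsIntegral.isIntegral x)).ne'
  obtain ⟨r, hr⟩ := IsAlgClosed.exists_root (P.map (residue A)) (by rwa [hP.degree_map])
  obtain ⟨a, rfl⟩ := residue_surjective r
  have hroot : v (algebraMap A Ω (P.eval a)) < 1 := by
    rw [hv.map_algebraMap_lt_one_iff, ← residue_eq_zero_iff, ← eval₂_at_apply, ← eval_map]
    exact hr
  have hprod : algebraMap A Ω (P.eval a) = ∏ z ∈ conj K x, (algebraMap A Ω a - z) := by
    rw [← aeval_minpoly_eq_prod_conj, ← hPx, aeval_map_algebraMap, aeval_algebraMap_apply]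
    rfl
  obtain ⟨z, hz, hlt⟩ : ∃ z ∈ conj K x, v (algebraMap A Ω a - z) < 1 := by
    by_contra! h
    rw [hprod, map_prod] at hroot
    exact hroot.not_ge (Finset.one_le_prod' h)
  obtain ⟨σ, rfl⟩ := (mem_conj_iff K).mp hz
  refine ⟨a, ?_⟩
  rwa [v.map_sub_swap, ← hv.map_algEquiv σ, map_sub, IsScalarTower.algebraMap_apply A K Ω,
    AlgEquiv.commutes, ← IsScalarTower.algebraMap_apply]

end Integrality

end IsNormalized

/-! ### Uniformizers and total ramification -/

section Uniformizers

/-- `π` is a uniformizer of `L`: it has value less than `1` and generates the value group of `L`. -/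
structure IsUniformizer {K Ω : Type*} [Field K] [Field Ω] [Algebra K Ω] (v : Valuation Ω ℝ≥0)
    (L : IntermediateField K Ω) (π : Ω) : Prop where
  mem : π ∈ L
  ne_zero : π ≠ 0
  map_lt_one : v π < 1
  exists_map_eq_zpow {x : Ω} : x ∈ L → x ≠ 0 → ∃ j : ℤ, v x = v π ^ j

namespace IsUniformizer

variable {K Ω : Type*} [Field K] [Field Ω] [Algebra K Ω] {v : Valuation Ω ℝ≥0}
  {L : IntermediateField K Ω} {π : Ω}

lemma map_pos (h : IsUniformizer v L π) : 0 < v π := v.pos_iff.mpr h.ne_zero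

lemma exists_map_eq_pow_succ (h : IsUniformizer v L π) {x : Ω} (hx : x ∈ L) (hx0 : x ≠ 0)
    (hx1 : v x < 1) : ∃ n : ℕ, v x = v π ^ (n + 1) := by
  obtain ⟨j, hj⟩ := h.exists_map_eq_zpow hx hx0
  have hj0 : 0 < j := by
    by_contra! hneg
    exact (hj ▸ hx1).not_ge (one_le_zpow_of_nonpos₀ h.map_pos h.map_lt_one.le hneg)
  obtain ⟨n, rfl⟩ := Int.eq_succ_of_zero_lt hj0
  exact ⟨n, by exact_mod_cast hj⟩

lemma map_le_of_lt_one (h : IsUniformizer v L π) {x : Ω} (hx : x ∈ L) (hx1 : v x < 1) :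
    v x ≤ v π := by
  obtain rfl | hx0 := eq_or_ne x 0
  · simp
  obtain ⟨n, hn⟩ := h.exists_map_eq_pow_succ hx hx0 hx1
  exact hn.trans_le (pow_le_of_le_one zero_le h.map_lt_one.le n.succ_ne_zero)

lemma map_le_pow_succ_of_lt_pow (h : IsUniformizer v L π) {x : Ω} (hx : x ∈ L) {n : ℕ}
    (hlt : v x < v π ^ n) : v x ≤ v π ^ (n + 1) := by
  have hpos : 0 < v π ^ n := pow_pos h.map_pos n
  rw [← div_lt_one hpos, ← map_pow, ← map_div₀] at hlt
  have hle := h.map_le_of_lt_one (div_mem hx (pow_mem h.mem n)) hlt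
  rwa [map_div₀, map_pow, div_le_iff₀ hpos, ← pow_succ'] at hle

lemma max_map_pow_succ (h : IsUniformizer v L π) {x : Ω} (hx : x ∈ L) (n : ℕ) :
    max (v x) (v π ^ (n + 1)) =
      max (v x) (v π ^ n) * if v x ≤ v π ^ (n + 1) then v π else 1 := by
  have hanti : v π ^ (n + 1) ≤ v π ^ n := pow_le_pow_right_of_le_one' h.map_lt_one.le n.le_succ
  split_ifs with hle
  · rw [max_eq_right hle, max_eq_right (hle.trans hanti), pow_succ]
  · have hpow := le_of_not_gt (mt (h.map_le_pow_succ_of_lt_pow hx) hle)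
    rw [max_eq_left (hanti.trans hpow), max_eq_left hpow, mul_one]

end IsUniformizer

variable {A K Ω : Type*} [CommRing A] [Field K] [Field Ω] [Algebra A K] [Algebra K Ω]

section Polynomials

variable [Algebra A Ω] [IsScalarTower A K Ω] (L : IntermediateField K Ω)

lemma algebraMap_mem (a : A) : algebraMap A Ω a ∈ L :=
  IsScalarTower.algebraMap_apply A K Ω a ▸ L.algebraMap_mem _

variable {L}

lemma aeval_mem (g : A[X]) {x : Ω} (hx : x ∈ L) : aeval x g ∈ L :=
  Algebra.adjoin_le (S := L.toSubalgebra.restrictScalars A) (Set.singleton_subset_iff.mpr hx)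
    (aeval_mem_adjoin_singleton A x)

end Polynomials

variable [IsDomain A] [IsDiscreteValuationRing A] {v : Valuation Ω ℝ≥0}
  {L : IntermediateField K Ω}

namespace IsNormalized

lemma exists_mem_forall_map_eq_zpow [IsGalois K Ω] (hv : IsNormalized A K v)
    (L : IntermediateField K Ω) [FiniteDimensional K L] :
    ∃ π ∈ L, π ≠ 0 ∧ ∀ x ∈ L, x ≠ 0 → ∃ j : ℤ, v x = v π ^ j := by
  set d := Module.finrank K L
  let H : AddSubgroup ℤ :=
    { carrier := {m | ∃ x ∈ L, x ≠ 0 ∧ v x ^ d = 2 ^ m}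
      zero_mem' := ⟨1, one_mem L, one_ne_zero, by simp⟩
      add_mem' := by
        rintro m n ⟨x, hx, hx0, hxm⟩ ⟨y, hy, hy0, hyn⟩
        exact ⟨x * y, mul_mem hx hy, mul_ne_zero hx0 hy0, by
          rw [map_mul, mul_pow, hxm, hyn, zpow_add₀ two_ne_zero]⟩
      neg_mem' := by
        rintro m ⟨x, hx, hx0, hxm⟩
        exact ⟨x⁻¹, inv_mem hx, inv_ne_zero hx0, by rw [map_inv₀, inv_pow, hxm, zpow_neg]⟩ }
  obtain ⟨a, ha⟩ := Int.subgroup_cyclic H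
  rw [← AddSubgroup.zmultiples_eq_closure] at ha
  obtain ⟨π, hπ, hπ0, hπa⟩ : a ∈ H := ha ▸ AddSubgroup.mem_zmultiples a
  refine ⟨π, hπ, hπ0, fun x hx hx0 ↦ ?_⟩
  obtain ⟨m, hm⟩ := hv.exists_map_pow_finrank_eq L hx hx0
  have hmH : m ∈ H := ⟨x, hx, hx0, hm⟩
  rw [ha] at hmH
  obtain ⟨j, rfl⟩ := AddSubgroup.mem_zmultiples_iff.mp hmH
  refine ⟨j, (pow_left_inj₀ zero_le zero_le (n := d) Module.finrank_pos.ne').mp ?_⟩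
  rw [hm, smul_eq_mul, mul_comm, zpow_mul, ← hπa, ← zpow_natCast, ← zpow_natCast, zpow_comm]

lemma exists_isUniformizer [IsGalois K Ω] (hv : IsNormalized A K v)
    (L : IntermediateField K Ω) [FiniteDimensional K L] : ∃ π, IsUniformizer v L π := by
  obtain ⟨π, hπ, hπ0, hgen⟩ := hv.exists_mem_forall_map_eq_zpow L
  obtain ⟨ϖ, hϖ⟩ := IsDiscreteValuationRing.exists_irreducible A
  have hne : v π ≠ 1 := fun h1 ↦ by
    have h2 := hv.map_irreducible hϖ
    obtain ⟨j, hj⟩ := hgen _ (L.algebraMap_mem (algebraMap A K ϖ))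
      (v.ne_zero_iff.mp (h2 ▸ by simp))
    rw [hj, h1, one_zpow] at h2
    norm_num at h2
  obtain hlt | hgt := hne.lt_or_gt
  · exact ⟨π, hπ, hπ0, hlt, hgen _⟩
  · refine ⟨π⁻¹, inv_mem hπ, inv_ne_zero hπ0, ?_, fun hx hx0 ↦ ?_⟩
    · rw [map_inv₀]
      exact inv_lt_one_of_one_lt₀ hgt
    · obtain ⟨j, hj⟩ := hgen _ hx hx0
      exact ⟨-j, by rw [hj, map_inv₀, inv_zpow', neg_neg]⟩

lemma isUniformizer_of_pow_finrank [IsGalois K Ω] (hv : IsNormalized A K v)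
    [FiniteDimensional K L] {π : Ω} (hπ : π ∈ L) (hpow : v π ^ Module.finrank K L = 2⁻¹) :
    IsUniformizer v L π where
  mem := hπ
  ne_zero := by
    rintro rfl
    simp [Module.finrank_pos.ne'] at hpow
  map_lt_one := by
    rw [← pow_lt_one_iff_of_nonneg zero_le (Module.finrank_pos (R := K) (M := L)).ne', hpow]
    norm_num
  exists_map_eq_zpow hx hx0 := by
    obtain ⟨n, hn⟩ := hv.exists_map_pow_finrank_eq L hx hx0
    refine ⟨-n, (pow_left_inj₀ zero_le zero_le
      (Module.finrank_pos (R := K) (M := L)).ne').mp ?_⟩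
    rw [hn, ← zpow_natCast, zpow_comm, zpow_natCast, hpow, inv_zpow', neg_neg]

variable [Algebra A Ω] [IsScalarTower A K Ω]

lemma exists_map_mul_le_one (hv : IsNormalized A K v) (x : Ω) :
    ∃ a : A, algebraMap A Ω a ≠ 0 ∧ v (algebraMap A Ω a * x) ≤ 1 := by
  obtain ⟨ϖ, hϖ⟩ := IsDiscreteValuationRing.exists_irreducible A
  obtain ⟨n, hn⟩ := pow_unbounded_of_one_lt (v x) one_lt_two
  refine ⟨ϖ ^ n, ?_, ?_⟩
  · rw [map_pow]
    exact pow_ne_zero n (hv.algebraMap_irreducible_ne_zero hϖ)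
  · rw [map_pow, map_mul, map_pow, hv.map_algebraMap_irreducible hϖ, inv_pow,
      inv_mul_le_iff₀ (by positivity), mul_one]
    exact hn.le

lemma exists_fg_integers [IsGalois K Ω] [IsFractionRing A K] (hv : IsNormalized A K v)
    (L : IntermediateField K Ω) [FiniteDimensional K L] :
    ∃ B : Submodule A Ω, B.FG ∧ ∀ y, y ∈ B ↔ y ∈ L ∧ v y ≤ 1 := by
  have hfin : Module.Finite A (integralClosure A L) :=
    IsIntegralClosure.finite A K L (integralClosure A L)
  let ι : L →ₐ[A] Ω := L.val.restrictScalars A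
  refine ⟨(Subalgebra.toSubmodule (integralClosure A L)).map ι.toLinearMap,
    Submodule.FG.map _ (Module.Finite.iff_fg.mp hfin), fun y ↦ ⟨?_, ?_⟩⟩
  · rintro ⟨z, hz, rfl⟩
    exact ⟨z.2, hv.isIntegral_iff.mp (IsIntegral.map ι hz)⟩
  · rintro ⟨hy, hy1⟩
    exact ⟨⟨y, hy⟩, (isIntegral_algHom_iff ι ι.injective).mp (hv.isIntegral_iff.mpr hy1), rfl⟩

lemma finrank_le_of_forall_exists_aeval_eq (hv : IsNormalized A K v) {π : Ω} {e : ℕ}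
    (h : ∀ x ∈ L, v x ≤ 1 → ∃ g ∈ degreeLT A e, aeval π g = x) : Module.finrank K L ≤ e := by
  have hspan : L.toSubmodule ≤ (degreeLT K e).map (aeval π).toLinearMap := by
    intro x hx
    obtain ⟨a, ha0, ha⟩ := hv.exists_map_mul_le_one x
    obtain ⟨g, hg, hgx⟩ := h _ (mul_mem (algebraMap_mem L a) hx) ha
    rw [IsScalarTower.algebraMap_apply A K Ω] at ha0 hgx
    refine ⟨C (algebraMap A K a)⁻¹ * g.map (algebraMap A K), ?_, ?_⟩
    · rw [SetLike.mem_coe, mem_degreeLT,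
        degree_C_mul (inv_ne_zero (ne_zero_of_map ha0))]
      exact degree_map_le.trans_lt (mem_degreeLT.mp hg)
    · rw [AlgHom.toLinearMap_apply, map_mul, aeval_C, aeval_map_algebraMap, hgx, map_inv₀,
        inv_mul_cancel_left₀ ha0]
  have : Module.Finite K (degreeLT K e) := Module.Finite.equiv (degreeLTEquiv K e).symm
  calc Module.finrank K L = Module.finrank K L.toSubmodule := rfl
    _ ≤ Module.finrank K ((degreeLT K e).map (aeval π).toLinearMap) :=
      Submodule.finrank_mono hspan
    _ ≤ Module.finrank K (degreeLT K e) := Submodule.finrank_map_le _ _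
    _ = e := by rw [(degreeLTEquiv K e).finrank_eq, Module.finrank_fin_fun]

end IsNormalized

section IsAlgClosed

variable [Algebra A Ω] [IsScalarTower A K Ω] [IsAlgClosed (ResidueField A)] [IsGalois K Ω] {π : Ω}

namespace IsUniformizer

lemma exists_map_sub_aeval_le (h : IsUniformizer v L π) (hv : IsNormalized A K v) (n : ℕ)
    {x : Ω} (hx : x ∈ L) (hx1 : v x ≤ 1) :
    ∃ g ∈ degreeLT A n, v (x - aeval π g) ≤ v π ^ n := by
  induction n with
  | zero => exact ⟨0, zero_mem _, by simpa using hx1⟩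
  | succ n ih =>
    obtain ⟨g, hg, hgx⟩ := ih
    have hπn : π ^ n ≠ 0 := pow_ne_zero _ h.ne_zero
    set t := (x - aeval π g) / π ^ n with ht
    have htL : t ∈ L := div_mem (sub_mem hx (aeval_mem g h.mem)) (pow_mem h.mem n)
    have ht1 : v t ≤ 1 := by
      rw [ht, map_div₀, map_pow]
      exact div_le_one_of_le₀ hgx zero_le
    obtain ⟨a, ha⟩ := hv.exists_map_sub_lt_one ht1
    refine ⟨g + C a * X ^ n, add_mem (degreeLT_mono n.le_succ hg) ?_, ?_⟩
    · rw [mem_degreeLT]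
      exact (degree_C_mul_X_pow_le n a).trans_lt (by exact_mod_cast n.lt_succ_self)
    · have hfactor : x - aeval π (g + C a * X ^ n) = π ^ n * (t - algebraMap A Ω a) := by
        rw [mul_sub, ht, mul_div_cancel₀ _ hπn, map_add, map_mul, aeval_C, map_pow, aeval_X]
        ring
      rw [hfactor, map_mul, map_pow, pow_succ]
      gcongr
      exact h.map_le_of_lt_one (sub_mem htL (algebraMap_mem L a)) ha

/-- Nakayama's lemma upgrades the approximation of `x` by polynomials in `π` to an equality. -/
lemma exists_aeval_eq_of_pow_eq [FiniteDimensional K L] (h : IsUniformizer v L π)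
    (hv : IsNormalized A K v) {e : ℕ} (he : v π ^ e = 2⁻¹) {x : Ω} (hx : x ∈ L) (hx1 : v x ≤ 1) :
    ∃ g ∈ degreeLT A e, aeval π g = x := by
  have : IsFractionRing A K := hv.integers.isFractionRing
  obtain ⟨ϖ, hϖ⟩ := IsDiscreteValuationRing.exists_irreducible A
  obtain ⟨B, hBfg, hB⟩ := hv.exists_fg_integers L
  have hjac : Ideal.span {ϖ} ≤ Ideal.jacobson ⊥ := by
    rw [jacobson_eq_maximalIdeal ⊥ bot_ne_top, hϖ.maximalIdeal_eq]
  have hle : B ≤ (degreeLT A e).map (aeval π).toLinearMap := by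
    refine Submodule.le_of_le_smul_of_le_jacobson_bot hBfg hjac fun y hy ↦ ?_
    obtain ⟨hyL, hy1⟩ := (hB y).mp hy
    obtain ⟨g, hg, hgy⟩ := h.exists_map_sub_aeval_le hv e hyL hy1
    have hsplit : y = aeval π g + ϖ • ((y - aeval π g) / algebraMap A Ω ϖ) := by
      rw [Algebra.smul_def, mul_div_cancel₀ _ (hv.algebraMap_irreducible_ne_zero hϖ),
        add_sub_cancel]
    rw [hsplit]
    refine Submodule.add_mem_sup ⟨g, hg, rfl⟩ (Submodule.smul_mem_smul
      (Ideal.mem_span_singleton_self _) ((hB _).mpr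
        ⟨div_mem (sub_mem hyL (aeval_mem g h.mem)) (algebraMap_mem L ϖ), ?_⟩))
    rw [map_div₀, hv.map_algebraMap_irreducible hϖ]
    exact div_le_one_of_le₀ (he ▸ hgy) zero_le
  exact hle ((hB x).mpr ⟨hx, hx1⟩)

variable [FiniteDimensional K L]

/-- As the residue field is algebraically closed, `L` is totally ramified over `K`. -/
theorem pow_finrank (h : IsUniformizer v L π) (hv : IsNormalized A K v) :
    v π ^ Module.finrank K L = 2⁻¹ := by
  obtain ⟨ϖ, hϖ⟩ := IsDiscreteValuationRing.exists_irreducible A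
  obtain ⟨j, hj⟩ := h.exists_map_eq_zpow (algebraMap_mem L ϖ)
    (hv.algebraMap_irreducible_ne_zero hϖ)
  rw [hv.map_algebraMap_irreducible hϖ] at hj
  have hj0 : 0 ≤ j := by
    by_contra! hneg
    have := one_le_zpow_of_nonpos₀ h.map_pos h.map_lt_one.le hneg.le
    rw [← hj] at this
    exact this.not_gt (by norm_num)
  obtain ⟨e, rfl⟩ := Int.eq_ofNat_of_zero_le hj0
  rw [zpow_natCast] at hj
  have hle : Module.finrank K L ≤ e := hv.finrank_le_of_forall_exists_aeval_eq
    fun x hx hx1 ↦ h.exists_aeval_eq_of_pow_eq hv hj.symm hx hx1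
  obtain ⟨m, hm⟩ := hv.exists_map_pow_finrank_eq L h.mem h.ne_zero
  have hme : m * e = -Module.finrank K L := by
    refine zpow_right_injective₀ (a := (2 : ℝ≥0)) (by norm_num) (by norm_num) ?_
    simp only [zpow_mul, ← hm, zpow_neg, zpow_natCast]
    rw [← pow_mul, mul_comm, pow_mul, ← hj, inv_pow]
  have hfin : 0 < Module.finrank K L := Module.finrank_pos
  have hm1 : m = -1 := by nlinarith
  rw [hm, hm1, zpow_neg_one]

lemma pow_eq_rpow (h : IsUniformizer v L π) (hv : IsNormalized A K v) (n : ℕ) :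
    v π ^ n = (2 : ℝ≥0) ^ (-(n / Module.finrank K L : ℝ)) := by
  have hπ : v π = (2⁻¹ : ℝ≥0) ^ (Module.finrank K L : ℝ)⁻¹ := by
    rw [← h.pow_finrank hv, NNReal.pow_rpow_inv_natCast _ Module.finrank_pos.ne']
  rw [hπ, NNReal.rpow_neg, NNReal.inv_rpow, inv_pow, ← NNReal.rpow_mul_natCast, inv_mul_eq_div]

lemma exists_aeval_eq (h : IsUniformizer v L π) (hv : IsNormalized A K v) {x : Ω} (hx : x ∈ L)
    (hx1 : v x ≤ 1) : ∃ g : A[X], aeval π g = x :=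
  (h.exists_aeval_eq_of_pow_eq hv (h.pow_finrank hv) hx hx1).imp fun _ ↦ And.right

lemma adjoin_eq (h : IsUniformizer v L π) (hv : IsNormalized A K v) :
    IntermediateField.adjoin K {π} = L := by
  refine le_antisymm (IntermediateField.adjoin_simple_le_iff.mpr h.mem) fun x hx ↦ ?_
  obtain ⟨a, ha0, ha⟩ := hv.exists_map_mul_le_one x
  obtain ⟨g, hg⟩ := h.exists_aeval_eq hv (mul_mem (algebraMap_mem L a) hx) ha
  rw [← inv_mul_cancel_left₀ ha0 x, ← hg]
  exact mul_mem (inv_mem (algebraMap_mem _ a))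
    (aeval_mem g (IntermediateField.mem_adjoin_simple_self K π))

lemma natDegree_minpoly (h : IsUniformizer v L π) (hv : IsNormalized A K v) :
    (minpoly K π).natDegree = Module.finrank K L := by
  rw [← IntermediateField.adjoin.finrank (Algebra.IsIntegral.isIntegral π), h.adjoin_eq hv]

end IsUniformizer

end IsAlgClosed

namespace IsNormalized

variable [IsGalois K Ω]

/-- A generalization of Eisenstein's criterion: the value `2 ^ (-1 / d)` forces degree at least
`d`. -/
lemma minpoly_eq_of_pow_natDegree (hv : IsNormalized A K v) {x : Ω} {P : K[X]} (hP : P.Monic)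
    (hx : aeval x P = 0) (hvx : v x ^ P.natDegree = 2⁻¹) : minpoly K x = P := by
  have h_int : IsIntegral K x := Algebra.IsIntegral.isIntegral x
  have hx0 : x ≠ 0 := by
    rintro rfl
    obtain h | h := eq_or_ne P.natDegree 0 <;> simp [h] at hvx
  obtain ⟨n, hn⟩ := hv.exists_map_eq_zpow (minpoly.coeff_zero_ne_zero h_int hx0)
  rw [← hv.map_pow_natDegree] at hn
  have hmul : n * P.natDegree = -((minpoly K x).natDegree : ℤ) := by
    refine zpow_right_injective₀ (a := (2 : ℝ≥0)) (by norm_num) (by norm_num) ?_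
    simp only [zpow_mul, ← hn, zpow_neg, zpow_natCast]
    rw [← pow_mul, mul_comm, pow_mul, hvx, inv_pow]
  have hdvd : P.natDegree ∣ (minpoly K x).natDegree :=
    Int.natCast_dvd_natCast.mp ⟨-n, by linarith⟩
  exact (eq_of_monic_of_dvd_of_natDegree_le (minpoly.monic h_int) hP (minpoly.dvd K x hx)
    (Nat.le_of_dvd (minpoly.natDegree_pos h_int) hdvd)).symm

lemma isUniformizer_adjoin (hv : IsNormalized A K v) {x : Ω} {P : K[X]} (hP : P.Monic)
    (hx : aeval x P = 0) (hvx : v x ^ P.natDegree = 2⁻¹) :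
    IsUniformizer v (IntermediateField.adjoin K {x}) x := by
  have h_int : IsIntegral K x := Algebra.IsIntegral.isIntegral x
  have := IntermediateField.adjoin.finiteDimensional h_int
  refine hv.isUniformizer_of_pow_finrank (IntermediateField.mem_adjoin_simple_self K x) ?_
  rw [IntermediateField.adjoin.finrank h_int, hv.minpoly_eq_of_pow_natDegree hP hx hvx, hvx]

end IsNormalized

end Uniformizers

/-! ### The Herbrand function -/

section HerbrandFunction

section Valuation

variable {F Γ : Type*} [Field F] [LinearOrderedCommGroupWithZero Γ] (v : Valuation F Γ)

lemma map_eval_le_prod {p : F[X]} (hp : ∀ i, v (p.coeff i) ≤ 1) {s : Finset F}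
    (hs : ∀ z ∈ s, v z ≤ 1 ∧ p.eval z = 0) {x : F} (hx : v x ≤ 1) :
    v (p.eval x) ≤ ∏ z ∈ s, v (x - z) := by
  classical
  obtain ⟨P, rfl⟩ : p ∈ lifts v.integer.subtype :=
    (lifts_iff_coeff_lifts _).mpr fun i ↦ ⟨⟨p.coeff i, hp i⟩, rfl⟩
  have heval (z : v.integer) : (P.map v.integer.subtype).eval (z : F) = P.eval z :=
    eval_map_apply v.integer.subtype z
  obtain rfl | hP := eq_or_ne P 0
  · simp
  have hroots : (s.subtype (· ∈ v.integer)).val ≤ P.roots := by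
    refine (Multiset.le_iff_subset (Finset.nodup _)).mpr fun z hz ↦ ?_
    rw [mem_roots hP, IsRoot.def, ← Subtype.coe_inj, ← heval]
    exact (hs z (Finset.mem_subtype.mp hz)).2
  obtain ⟨Q, hQ⟩ := (Multiset.prod_X_sub_C_dvd_iff_le_roots hP _).mpr hroots
  have hprod : P.eval ⟨x, hx⟩ = (∏ z ∈ s, (x - z)) * (Q.eval ⟨x, hx⟩ : v.integer) := by
    rw [hQ, ← Finset.prod_eq_multiset_prod, eval_mul, eval_prod, Subring.coe_mul,
      ← Finset.prod_subtype_of_mem (p := (· ∈ v.integer)) (x - ·) fun z hz ↦ (hs z hz).1]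
    congr 1
    push_cast
    simp
  change v ((P.map v.integer.subtype).eval ((⟨x, hx⟩ : v.integer) : F)) ≤ _
  rw [heval, hprod, map_mul, map_prod]
  exact mul_le_of_le_one_right' (Q.eval _).2

lemma map_sub_eq_max {a b c : F} (h : v (b - c) ≤ v (a - c)) :
    v (a - c) = max (v (a - b)) (v (b - c)) := by
  refine le_antisymm ?_ (max_le ?_ h)
  · rw [← sub_add_sub_cancel a b c]
    exact v.map_add _ _
  · rw [← sub_sub_sub_cancel_right a b c]
    exact (v.map_sub _ _).trans_eq (max_eq_left h)

end Valuation

variable {A K Ω : Type*} [CommRing A] [Field K] [Field Ω] [Algebra K Ω]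
  {v : Valuation Ω ℝ≥0} {x : Ω}

variable (K v) in
/-- `∏ max (v (z - x)) r` over the conjugates `z` of `x`.  For a uniformizer `x` of `L`, this
is the value at `r` of the (multiplicatively written) Herbrand function of `L / K`. -/
noncomputable def herbrand (x : Ω) (r : ℝ≥0) : ℝ≥0 := ∏ z ∈ conj K x, max (v (z - x)) r

lemma herbrand_mono (x : Ω) : Monotone (herbrand K v x) := fun _ _ h ↦
  Finset.prod_le_prod' fun _ _ ↦ max_le_max le_rfl h

section Fiber

variable [Algebra A Ω]

variable (K) in
open Classical in
/-- The conjugates of `x` at which the polynomial `g` takes the value `w`. -/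
noncomputable def conjFiber (g : A[X]) (x w : Ω) : Finset Ω := (conj K x).filter (aeval · g = w)

lemma mem_conjFiber {g : A[X]} {w z : Ω} :
    z ∈ conjFiber K g x w ↔ z ∈ conj K x ∧ aeval z g = w := by
  simp [conjFiber]

variable [Algebra A K] [IsScalarTower A K Ω]

lemma algEquiv_aeval (g : A[X]) (σ : Gal(Ω/K)) (x : Ω) : σ (aeval x g) = aeval (σ x) g :=
  (aeval_algHom_apply (σ.toAlgHom.restrictScalars A) x g).symm

variable [IsGalois K Ω]

lemma aeval_mem_conj (g : A[X]) {z : Ω} (hz : z ∈ conj K x) : aeval z g ∈ conj K (aeval x g) := by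
  obtain ⟨σ, rfl⟩ := (mem_conj_iff K).mp hz
  exact (mem_conj_iff K).mpr ⟨σ, algEquiv_aeval g σ x⟩

lemma apply_mem_conjFiber (σ : Gal(Ω/K)) {g : A[X]} {w z : Ω} (hz : z ∈ conjFiber K g x w) :
    σ z ∈ conjFiber K g x (σ w) := by
  obtain ⟨hzx, rfl⟩ := mem_conjFiber.mp hz
  exact mem_conjFiber.mpr ⟨apply_mem_conj K σ hzx, (algEquiv_aeval g σ z).symm⟩

lemma prod_conjFiber_apply {M : Type*} [CommMonoid M] (σ : Gal(Ω/K)) (g : A[X]) (x w : Ω)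
    (f : Ω → M) : ∏ z ∈ conjFiber K g x (σ w), f z = ∏ z ∈ conjFiber K g x w, f (σ z) := by
  refine (Finset.prod_bij' (fun z _ ↦ σ z) (fun z _ ↦ σ⁻¹ z)
    (fun z hz ↦ apply_mem_conjFiber σ hz) (fun z hz ↦ ?_) ?_ ?_ fun _ _ ↦ rfl).symm
  · simpa using apply_mem_conjFiber σ⁻¹ hz
  · simp
  · simp

lemma coeff_prod_conjFiber_mem {T : IntermediateField K Ω} {g : A[X]} (hT : aeval x g ∈ T)
    (i : ℕ) : (∏ z ∈ conjFiber K g x (aeval x g), (X - C z)).coeff i ∈ T := by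
  rw [← InfiniteGalois.fixedField_fixingSubgroup T, IntermediateField.mem_fixedField_iff]
  intro τ hτ
  have hfix : τ (aeval x g) = aeval x g := (IntermediateField.mem_fixingSubgroup_iff T τ).mp hτ _ hT
  have hmap : (∏ z ∈ conjFiber K g x (aeval x g), (X - C z)).map (τ : Ω →+* Ω) =
      ∏ z ∈ conjFiber K g x (aeval x g), (X - C z) := by
    conv_rhs => rw [← hfix, prod_conjFiber_apply]
    simp [Polynomial.map_prod]
  conv_rhs => rw [← hmap]
  rw [coeff_map]
  rfl

lemma exists_closest (v : Valuation Ω ℝ≥0) {g : A[X]} {w : Ω} (hw : w ∈ conj K (aeval x g)) :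
    ∃ z ∈ conjFiber K g x w, ∀ z' ∈ conjFiber K g x w, v (z - x) ≤ v (z' - x) := by
  refine Finset.exists_min_image _ _ ?_
  obtain ⟨σ, rfl⟩ := (mem_conj_iff K).mp hw
  exact ⟨σ x, apply_mem_conjFiber σ (mem_conjFiber.mpr ⟨self_mem_conj K x, rfl⟩)⟩

namespace IsNormalized

lemma map_sub_le_prod_conjFiber (hv : IsNormalized A K v) (hx : v x ≤ 1) (g : A[X]) {w : Ω}
    (hw : v w ≤ 1) : v (w - aeval x g) ≤ ∏ z ∈ conjFiber K g x w, v (z - x) := by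
  have h := map_eval_le_prod v (p := g.map (algebraMap A Ω) - C w) (s := conjFiber K g x w)
    (fun i ↦ ?_) (fun z hz ↦ ?_) hx
  · simpa [v.map_sub_swap, eval_map_algebraMap] using h
  · rw [coeff_sub, coeff_map, coeff_C]
    refine v.map_sub_le (hv.map_algebraMap_le_one _) ?_
    split_ifs
    · exact hw
    · simp
  · obtain ⟨hzx, rfl⟩ := mem_conjFiber.mp hz
    exact ⟨(hv.map_conj hzx).trans_le hx, by simp [eval_map_algebraMap]⟩

lemma prod_conjFiber_max (hv : IsNormalized A K v) {g : A[X]} {z w : Ω}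
    (hz : z ∈ conjFiber K g x w) (hmin : ∀ z' ∈ conjFiber K g x w, v (z - x) ≤ v (z' - x))
    (r : ℝ≥0) :
    ∏ z' ∈ conjFiber K g x w, max (v (z' - x)) r =
      ∏ z' ∈ conjFiber K g x (aeval x g), max (v (z' - x)) (max (v (z - x)) r) := by
  obtain ⟨hzx, rfl⟩ := mem_conjFiber.mp hz
  obtain ⟨σ, rfl⟩ := (mem_conj_iff K).mp hzx
  rw [← algEquiv_aeval] at hmin ⊢
  rw [prod_conjFiber_apply]
  refine Finset.prod_congr rfl fun z' hz' ↦ ?_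
  rw [map_sub_eq_max v (hmin _ (apply_mem_conjFiber σ hz')), ← map_sub, hv.map_algEquiv, max_assoc]

end IsNormalized

end Fiber

section Herbrand

variable [IsDomain A] [IsDiscreteValuationRing A] [IsAlgClosed (ResidueField A)]
  [Algebra A K] [Algebra A Ω] [IsScalarTower A K Ω] [IsGalois K Ω]
  {T : IntermediateField K Ω} [FiniteDimensional K T] {g : A[X]}

namespace IsUniformizer

lemma prod_conjFiber_le (hv : IsNormalized A K v) (hy : IsUniformizer v T (aeval x g))
    (hx : v x ≤ 1) (σ : Gal(Ω/K)) :
    ∏ z ∈ conjFiber K g x (σ (aeval x g)), v (z - x) ≤ v (σ (aeval x g) - aeval x g) := by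
  set y := aeval x g with hgy
  let f : Polynomial Ω := ∏ z ∈ conjFiber K g x y, (X - C z)
  have hcoeff (i : ℕ) : v (σ (f.coeff i) - f.coeff i) ≤ v (σ y - y) := by
    have h_int : v (f.coeff i) ≤ 1 := map_coeff_prod_X_sub_C_le_one v
      (fun z hz ↦ (hv.map_conj (mem_conjFiber.mp hz).1).trans_le hx) i
    obtain ⟨r, hr⟩ := hy.exists_aeval_eq hv (coeff_prod_conjFiber_mem hy.mem i) h_int
    rw [← hr, algEquiv_aeval]
    exact hv.map_aeval_sub_aeval_le r (hv.map_algEquiv σ y ▸ hy.map_lt_one.le) hy.map_lt_one.le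
  have hfx : f.eval x = 0 := by
    rw [eval_prod]
    exact Finset.prod_eq_zero (mem_conjFiber.mpr ⟨self_mem_conj K x, hgy.symm⟩) (by simp)
  have hσf : v ((f.map (σ : Ω →+* Ω)).eval x) = ∏ z ∈ conjFiber K g x (σ y), v (z - x) := by
    rw [prod_conjFiber_apply, Polynomial.map_prod, eval_prod, map_prod]
    refine Finset.prod_congr rfl fun z _ ↦ ?_
    simp [v.map_sub_swap]
  rw [← hσf, ← sub_zero (eval x _), ← hfx, ← eval_sub, eval_eq_sum_range]
  refine v.map_sum_le fun i _ ↦ ?_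
  rw [map_mul, map_pow, coeff_sub, coeff_map]
  exact (mul_le_of_le_one_right' (pow_le_one' hx i)).trans (hcoeff i)

lemma map_sub_eq_prod_conjFiber (hv : IsNormalized A K v) (hy : IsUniformizer v T (aeval x g))
    (hx : v x ≤ 1) {w : Ω} (hw : w ∈ conj K (aeval x g)) :
    v (w - aeval x g) = ∏ z ∈ conjFiber K g x w, v (z - x) := by
  refine le_antisymm
    (hv.map_sub_le_prod_conjFiber hx g ((hv.map_conj hw).trans_le hy.map_lt_one.le)) ?_
  obtain ⟨σ, rfl⟩ := (mem_conj_iff K).mp hw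
  exact hy.prod_conjFiber_le hv hx σ

/-- Herbrand's theorem: compatibility of the upper numbering with passage to a subfield. -/
theorem herbrand_aeval (hv : IsNormalized A K v) (hy : IsUniformizer v T (aeval x g))
    (hx : v x ≤ 1) {w z : Ω} (hz : z ∈ conjFiber K g x w)
    (hmin : ∀ z' ∈ conjFiber K g x w, v (z - x) ≤ v (z' - x)) :
    herbrand K v (aeval x g) (v (w - aeval x g)) = herbrand K v x (v (z - x)) := by
  classical
  set y := aeval x g
  have hwy : w ∈ conj K y := by
    obtain ⟨hzx, rfl⟩ := mem_conjFiber.mp hz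
    exact aeval_mem_conj g hzx
  let Φ (r : ℝ≥0) : ℝ≥0 := ∏ z' ∈ conjFiber K g x y, max (v (z' - x)) r
  have hΦ : Monotone Φ := fun _ _ h ↦ Finset.prod_le_prod' fun _ _ ↦ max_le_max le_rfl h
  have hsub {w' z' : Ω} (hw' : w' ∈ conj K y) (hz' : z' ∈ conjFiber K g x w')
      (hmin' : ∀ z'' ∈ conjFiber K g x w', v (z' - x) ≤ v (z'' - x)) :
      v (w' - y) = Φ (v (z' - x)) := by
    rw [hy.map_sub_eq_prod_conjFiber hv hx hw']
    simpa using hv.prod_conjFiber_max hz' hmin' 0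
  rw [herbrand, herbrand, ← Finset.prod_fiberwise_of_maps_to (g := (aeval · g))
    fun z' ↦ aeval_mem_conj (x := x) g]
  refine Finset.prod_congr rfl fun w' hw' ↦ ?_
  obtain ⟨z', hz', hmin'⟩ := exists_closest v hw'
  rw [hsub hw' hz' hmin', hsub hwy hz hmin, ← hΦ.map_max]
  refine (hv.prod_conjFiber_max hz' hmin' (v (z - x))).symm.trans ?_
  exact Finset.prod_congr (by ext; simp [conjFiber]) fun _ _ ↦ rfl

end IsUniformizer

end Herbrand

end HerbrandFunction

/-! ### Upper ramification breaks -/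

section UpperBreaks

lemma exists_apply_ne_of_mem_adjoin {K Ω : Type*} [Field K] [Field Ω] [Algebra K Ω]
    {σ : Gal(Ω/K)} {S : Set Ω} {x : Ω} (hx : x ∈ IntermediateField.adjoin K S) (hσ : σ x ≠ x) :
    ∃ y ∈ S, σ y ≠ y := by
  contrapose! hσ
  induction hx using IntermediateField.adjoin_induction with
  | mem y hy => exact hσ y hy
  | algebraMap y => exact σ.commutes y
  | add y z _ _ hy hz => rw [map_add, hy, hz]
  | inv y _ hy => rw [map_inv₀, hy]
  | mul y z _ _ hy hz => rw [map_mul, hy, hz]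

section Breaks

variable {K Ω : Type*} [Field K] [Field Ω] [Algebra K Ω]

/-- The upper ramification breaks of `L / K` are at most `h`. The Herbrand function is read
multiplicatively and in the normalization `v (σ x - x)`, rather than `v (σ x / x - 1)`, of the
lower breaks, hence the shift of `h` by `1`. -/
def BreaksLE (v : Valuation Ω ℝ≥0) (L : IntermediateField K Ω) (h : ℝ) : Prop :=
  ∀ x, IsUniformizer v L x → ∀ z ∈ conj K x, z ≠ x →
    (2 : ℝ≥0) ^ (-(h + 1)) ≤ herbrand K v x (v (z - x))

/-- Some upper ramification break of `L / K` is at least `h`, normalized as in `BreaksLE`. -/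
def HasBreakGE (v : Valuation Ω ℝ≥0) (L : IntermediateField K Ω) (h : ℝ) : Prop :=
  ∀ x, IsUniformizer v L x → ∃ z ∈ conj K x, z ≠ x ∧
    herbrand K v x (v (z - x)) ≤ (2 : ℝ≥0) ^ (-(h + 1))

lemma BreaksLE.of_le {v : Valuation Ω ℝ≥0} {L : IntermediateField K Ω} {h h' : ℝ}
    (hL : BreaksLE v L h) (hh : h ≤ h') : BreaksLE v L h' := fun x hx z hz hzx ↦
  (NNReal.rpow_le_rpow_of_exponent_le one_le_two (by linarith)).trans (hL x hx z hz hzx)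

end Breaks

variable {A K Ω : Type*} [CommRing A] [IsDomain A] [IsDiscreteValuationRing A]
  [IsAlgClosed (ResidueField A)] [Field K] [Field Ω] [Algebra A K] [Algebra K Ω]
  [IsGalois K Ω] [Algebra A Ω] [IsScalarTower A K Ω] {v : Valuation Ω ℝ≥0}
  {T L L₁ L₂ : IntermediateField K Ω} [FiniteDimensional K T] [FiniteDimensional K L]
  [FiniteDimensional K L₁] [FiniteDimensional K L₂] {x y : Ω} {h h' : ℝ}

namespace IsUniformizer

lemma exists_herbrand_eq (hv : IsNormalized A K v) (hTL : T ≤ L) (hy : IsUniformizer v T y)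
    (hx : IsUniformizer v L x) {w : Ω} (hw : w ∈ conj K y) (hwy : w ≠ y) :
    ∃ z ∈ conj K x, z ≠ x ∧ herbrand K v y (v (w - y)) = herbrand K v x (v (z - x)) := by
  obtain ⟨g, rfl⟩ := hx.exists_aeval_eq hv (hTL hy.mem) hy.map_lt_one.le
  obtain ⟨z, hz, hmin⟩ := exists_closest v hw
  refine ⟨z, (mem_conjFiber.mp hz).1, ?_, hy.herbrand_aeval hv hx.map_lt_one.le hz hmin⟩
  rintro rfl
  exact hwy (mem_conjFiber.mp hz).2.symm

lemma herbrand_le (hv : IsNormalized A K v) (hTL : T ≤ L) (hy : IsUniformizer v T y)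
    (hx : IsUniformizer v L x) (σ : Gal(Ω/K)) :
    herbrand K v y (v (σ y - y)) ≤ herbrand K v x (v (σ x - x)) := by
  obtain ⟨g, rfl⟩ := hx.exists_aeval_eq hv (hTL hy.mem) hy.map_lt_one.le
  obtain ⟨z, hz, hmin⟩ := exists_closest v (apply_mem_conj K σ (self_mem_conj K (aeval x g)))
  rw [hy.herbrand_aeval hv hx.map_lt_one.le hz hmin]
  exact herbrand_mono x (hmin _ (apply_mem_conjFiber σ
    (mem_conjFiber.mpr ⟨self_mem_conj K x, rfl⟩)))

lemma apply_ne_or_apply_ne (hv : IsNormalized A K v) {y₁ y₂ : Ω} (h₁ : IsUniformizer v L₁ y₁)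
    (h₂ : IsUniformizer v L₂ y₂) (hx : x ∈ L₁ ⊔ L₂) {σ : Gal(Ω/K)} (hσ : σ x ≠ x) :
    σ y₁ ≠ y₁ ∨ σ y₂ ≠ y₂ := by
  rw [← h₁.adjoin_eq hv, ← h₂.adjoin_eq hv, ← IntermediateField.adjoin_union,
    Set.singleton_union] at hx
  simpa using exists_apply_ne_of_mem_adjoin hx hσ

lemma hasBreakGE (hy : IsUniformizer v T y) (hv : IsNormalized A K v) (hTL : T ≤ L) {w : Ω}
    (hw : w ∈ conj K y) (hwy : w ≠ y)
    (hle : herbrand K v y (v (w - y)) ≤ (2 : ℝ≥0) ^ (-(h + 1))) : HasBreakGE v L h := by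
  intro x hx
  obtain ⟨z, hz, hzx, he⟩ := hy.exists_herbrand_eq hv hTL hx hw hwy
  exact ⟨z, hz, hzx, he ▸ hle⟩

end IsUniformizer

lemma BreaksLE.mono (hL : BreaksLE v L h) (hv : IsNormalized A K v) (hTL : T ≤ L) :
    BreaksLE v T h := by
  intro y hy w hw hwy
  obtain ⟨x, hx⟩ := hv.exists_isUniformizer L
  obtain ⟨z, hz, hzx, he⟩ := hy.exists_herbrand_eq hv hTL hx hw hwy
  exact he ▸ hL x hx z hz hzx

lemma HasBreakGE.mono (hT : HasBreakGE v T h) (hv : IsNormalized A K v) (hTL : T ≤ L) :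
    HasBreakGE v L h := by
  obtain ⟨y, hy⟩ := hv.exists_isUniformizer T
  obtain ⟨w, hw, hwy, hle⟩ := hT y hy
  exact hy.hasBreakGE hv hTL hw hwy hle

lemma BreaksLE.sup (h₁ : BreaksLE v L₁ h) (h₂ : BreaksLE v L₂ h) (hv : IsNormalized A K v) :
    BreaksLE v (L₁ ⊔ L₂) h := by
  intro x hx z hz hzx
  obtain ⟨σ, rfl⟩ := (mem_conj_iff K).mp hz
  obtain ⟨y₁, hy₁⟩ := hv.exists_isUniformizer L₁
  obtain ⟨y₂, hy₂⟩ := hv.exists_isUniformizer L₂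
  obtain hne | hne := hy₁.apply_ne_or_apply_ne hv hy₂ hx.mem hzx
  · exact (h₁ y₁ hy₁ _ (apply_mem_conj K σ (self_mem_conj K _)) hne).trans
      (hy₁.herbrand_le hv le_sup_left hx σ)
  · exact (h₂ y₂ hy₂ _ (apply_mem_conj K σ (self_mem_conj K _)) hne).trans
      (hy₂.herbrand_le hv le_sup_right hx σ)

lemma HasBreakGE.of_sup (hGE : HasBreakGE v (L₁ ⊔ L₂) h) (h₂ : BreaksLE v L₂ h') (hlt : h' < h)
    (hv : IsNormalized A K v) : HasBreakGE v L₁ h := by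
  intro y₁ hy₁
  obtain ⟨y₂, hy₂⟩ := hv.exists_isUniformizer L₂
  obtain ⟨x, hx⟩ := hv.exists_isUniformizer (L₁ ⊔ L₂)
  obtain ⟨z, hz, hzx, hle⟩ := hGE x hx
  obtain ⟨σ, rfl⟩ := (mem_conj_iff K).mp hz
  obtain hne | hne := hy₁.apply_ne_or_apply_ne hv hy₂ hx.mem hzx
  · exact ⟨σ y₁, apply_mem_conj K σ (self_mem_conj K _), hne,
      (hy₁.herbrand_le hv le_sup_left hx σ).trans hle⟩
  · have hpow : (2 : ℝ≥0) ^ (-(h' + 1)) ≤ 2 ^ (-(h + 1)) :=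
      ((h₂ y₂ hy₂ _ (apply_mem_conj K σ (self_mem_conj K _)) hne).trans
        (hy₂.herbrand_le hv le_sup_right hx σ)).trans hle
    exact absurd hpow
      (NNReal.rpow_lt_rpow_of_exponent_lt one_lt_two (by linarith)).not_ge

/-- For the conjugate `z₀` closest to `x`, the value of the Herbrand function at `v (z₀ - x)` is
the value of the different times `v (z₀ - x)`. -/
lemma HasBreakGE.of_derivative (hv : IsNormalized A K v) (hx : IsUniformizer v L x) {z : Ω}
    (hz : z ∈ conj K x) (hzx : z ≠ x)
    (hle : v (aeval x (derivative (minpoly K x))) * v (z - x) ≤ (2 : ℝ≥0) ^ (-(h + 1))) :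
    HasBreakGE v L h := by
  classical
  have hze : z ∈ (conj K x).erase x := Finset.mem_erase.mpr ⟨hzx, hz⟩
  obtain ⟨z₀, hz₀, hmin⟩ :=
    Finset.exists_min_image ((conj K x).erase x) (fun w ↦ v (w - x)) ⟨z, hze⟩
  obtain ⟨hne, hz₀x⟩ := Finset.mem_erase.mp hz₀
  refine hx.hasBreakGE hv le_rfl hz₀x hne (le_trans (le_of_eq ?_)
    ((mul_le_mul_right (hmin z hze) _).trans hle))
  rw [herbrand, ← Finset.mul_prod_erase _ _ (self_mem_conj K x), mul_comm,
    aeval_derivative_minpoly_eq_prod_conj, map_prod]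
  congr 1
  · refine Finset.prod_congr rfl fun w hw ↦ ?_
    rw [max_eq_left (hmin w hw), v.map_sub_swap]
  · simp

end UpperBreaks

/-! ### The conductor -/

section Conductor

variable (A K L : Type*) [CommRing A] [Field K] [Field L] [Algebra A K] [Algebra K L] [Algebra A L]
  [IsScalarTower A K L]

lemma lowerGroup_antitone : Antitone (lowerGroup A K L) := fun _ _ hst _ hg π hπ ↦
  Ideal.pow_le_pow_right (by gcongr) (hg π hπ)

lemma lowerGroup_natCeil (t : ℝ) : lowerGroup A K L ⌈t⌉₊ = lowerGroup A K L t := by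
  ext g
  change (∀ _, _ → _) ↔ (∀ _, _ → _)
  rw [Nat.ceil_natCast]

lemma phi_zero : phi A K L 0 = 0 := intervalIntegral.integral_same

variable [FiniteDimensional K L]

lemma antitone_card_div : Antitone fun t : ℝ ↦
    (Nat.card (lowerGroup A K L t) : ℝ) / Nat.card (lowerGroup A K L 0) := by
  intro s t hst
  dsimp only
  gcongr
  exact Nat.card_mono (Set.toFinite _) (lowerGroup_antitone A K L hst)

lemma inv_card_le_card_div (t : ℝ) : (Nat.card (lowerGroup A K L 0) : ℝ)⁻¹ ≤
    (Nat.card (lowerGroup A K L t) : ℝ) / Nat.card (lowerGroup A K L 0) := by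
  rw [← one_div]
  gcongr
  exact_mod_cast Nat.card_pos

lemma phi_sub_phi (s t : ℝ) : phi A K L t - phi A K L s = ∫ x in s..t,
    (Nat.card (lowerGroup A K L x) : ℝ) / Nat.card (lowerGroup A K L 0) :=
  intervalIntegral.integral_interval_sub_left
    (antitone_card_div A K L).intervalIntegrable (antitone_card_div A K L).intervalIntegrable

lemma inv_card_mul_sub_le_phi_sub {s t : ℝ} (hst : s ≤ t) :
    (Nat.card (lowerGroup A K L 0) : ℝ)⁻¹ * (t - s) ≤ phi A K L t - phi A K L s := by
  rw [phi_sub_phi, mul_comm, ← smul_eq_mul, ← intervalIntegral.integral_const]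
  exact intervalIntegral.integral_mono_on hst intervalIntegrable_const
    (antitone_card_div A K L).intervalIntegrable fun x _ ↦ inv_card_le_card_div A K L x

lemma inv_card_lowerGroup_pos (t : ℝ) : 0 < (Nat.card (lowerGroup A K L t) : ℝ)⁻¹ :=
  inv_pos.mpr (Nat.cast_pos.mpr Nat.card_pos)

lemma phi_strictMono : StrictMono (phi A K L) := fun _ _ hst ↦ sub_pos.mp <|
  (mul_pos (inv_card_lowerGroup_pos A K L 0) (sub_pos.mpr hst)).trans_le
    (inv_card_mul_sub_le_phi_sub A K L hst.le)

lemma phi_continuous : Continuous (phi A K L) :=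
  intervalIntegral.continuous_primitive
    (fun _ _ ↦ (antitone_card_div A K L).intervalIntegrable) 0

lemma exists_phi_eq {i : ℝ} (hi : 0 ≤ i) : ∃ u ∈ Set.Ici (0 : ℝ), phi A K L u = i := by
  set d := (Nat.card (lowerGroup A K L 0) : ℝ)⁻¹ with hd
  have hd0 : 0 < d := inv_card_lowerGroup_pos A K L 0
  have hi_le : i ≤ phi A K L (i / d) := by
    have hphi := inv_card_mul_sub_le_phi_sub A K L (div_nonneg hi hd0.le)
    rwa [phi_zero, sub_zero, sub_zero, ← hd, mul_div_cancel₀ _ hd0.ne'] at hphi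
  obtain ⟨u, hu, hui⟩ := intermediate_value_Icc (div_nonneg hi hd0.le)
    (phi_continuous A K L).continuousOn ⟨(phi_zero A K L).trans_le hi, hi_le⟩
  exact ⟨u, hu.1, hui⟩

lemma psi_nonneg {i : ℝ} (hi : 0 ≤ i) : 0 ≤ psi A K L i :=
  Function.invFunOn_mem (exists_phi_eq A K L hi)

lemma phi_psi {i : ℝ} (hi : 0 ≤ i) : phi A K L (psi A K L i) = i :=
  Function.invFunOn_eq (exists_phi_eq A K L hi)

lemma conductor_eq_phi {N : ℝ} (hN : 0 ≤ N)
    (h : ∀ t, 0 ≤ t → (lowerGroup A K L t ≠ ⊥ ↔ t ≤ N)) : conductor A K L = phi A K L N := by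
  have hset : {i : ℝ | 0 ≤ i ∧ upperGroup A K L i ≠ ⊥} = Set.Icc 0 (phi A K L N) := by
    ext i
    refine and_congr_right fun hi ↦ ?_
    rw [upperGroup, h _ (psi_nonneg A K L hi), ← (phi_strictMono A K L).le_iff_le,
      phi_psi A K L hi]
  rw [conductor, hset, csSup_Icc]
  rw [← phi_zero A K L]
  exact (phi_strictMono A K L).monotone hN

lemma phi_natCast (N : ℕ) : phi A K L N = ∑ j ∈ Finset.range N,
    (Nat.card (lowerGroup A K L (j + 1 : ℕ)) : ℝ) / Nat.card (lowerGroup A K L 0) := by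
  induction N with
  | zero => simp [phi_zero]
  | succ n ih =>
    have hconst : ∫ x in (n : ℝ)..((n + 1 : ℕ) : ℝ),
        (Nat.card (lowerGroup A K L x) : ℝ) / Nat.card (lowerGroup A K L 0) =
        ∫ _ in (n : ℝ)..((n + 1 : ℕ) : ℝ),
          (Nat.card (lowerGroup A K L (n + 1 : ℕ)) : ℝ) / Nat.card (lowerGroup A K L 0) := by
      refine intervalIntegral.integral_congr_ae (Filter.Eventually.of_forall fun x hx ↦ ?_)
      rw [Set.uIoc_of_le (by simp)] at hx
      have hceil : ⌈x⌉₊ = n + 1 :=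
        (Nat.ceil_eq_iff n.succ_ne_zero).mpr ⟨by simpa using hx.1, hx.2⟩
      rw [← lowerGroup_natCeil, hceil]
    rw [Finset.sum_range_succ, ← ih, ← sub_eq_iff_eq_add', phi_sub_phi, hconst,
      intervalIntegral.integral_const]
    simp

end Conductor

section Integers

variable {A K Ω : Type*} [CommRing A] [Field K] [Field Ω] [Algebra A K] [Algebra K Ω]
  [IsGalois K Ω] [Algebra A Ω] [IsScalarTower A K Ω] {v : Valuation Ω ℝ≥0}
  {L : IntermediateField K Ω}

namespace IsNormalized

lemma map_coe_le_one (hv : IsNormalized A K v) (x : integralClosure A L) : v ((x : L) : Ω) ≤ 1 :=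
  hv.isIntegral_iff.mp (IsIntegral.map (L.val.restrictScalars A) x.2)

/-- An element of `L` of valuation at most `1`, as an element of the valuation ring. -/
def mkInteger (hv : IsNormalized A K v) (x : Ω) (hx : x ∈ L) (hx1 : v x ≤ 1) :
    integralClosure A L :=
  ⟨⟨x, hx⟩, (isIntegral_algHom_iff (L.val.restrictScalars A) (L.val.restrictScalars A).injective).mp
    (hv.isIntegral_iff.mpr hx1)⟩

lemma dvd_iff (hv : IsNormalized A K v) {x y : integralClosure A L} :
    y ∣ x ↔ v ((x : L) : Ω) ≤ v ((y : L) : Ω) := by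
  refine ⟨?_, fun hle ↦ ?_⟩
  · rintro ⟨z, rfl⟩
    push_cast
    rw [map_mul]
    exact mul_le_of_le_one_right' (hv.map_coe_le_one z)
  obtain rfl | hy := eq_or_ne y 0
  · have hx : x = 0 := by simpa using hle
    rw [hx]
  have hy' : ((y : L) : Ω) ≠ 0 := by simpa using hy
  refine ⟨hv.mkInteger ((x : L) / (y : L)) (div_mem (x : L).2 (y : L).2) ?_, ?_⟩
  · rw [map_div₀]
    exact div_le_one_of_le₀ hle zero_le
  · exact Subtype.ext (Subtype.ext (mul_div_cancel₀ _ hy').symm)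

lemma isUnit_iff (hv : IsNormalized A K v) {x : integralClosure A L} :
    IsUnit x ↔ v ((x : L) : Ω) = 1 := by
  simp [isUnit_iff_dvd_one, hv.dvd_iff, (hv.map_coe_le_one x).ge_iff_eq]

lemma not_isUnit_iff (hv : IsNormalized A K v) {x : integralClosure A L} :
    ¬IsUnit x ↔ v ((x : L) : Ω) < 1 := by
  rw [hv.isUnit_iff, (hv.map_coe_le_one x).lt_iff_ne]

lemma isLocalRing_integralClosure (hv : IsNormalized A K v) (L : IntermediateField K Ω) :
    IsLocalRing (integralClosure A L) := by
  refine IsLocalRing.of_nonunits_add fun a b ha hb ↦ ?_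
  rw [mem_nonunits_iff, hv.not_isUnit_iff] at ha hb ⊢
  exact v.map_add_lt ha hb

end IsNormalized

namespace IsUniformizer

variable {π : Ω}

lemma maxIdeal_eq (h : IsUniformizer v L π) (hv : IsNormalized A K v) :
    maxIdeal A L = Ideal.span {hv.mkInteger π h.mem h.map_lt_one.le} := by
  have := hv.isLocalRing_integralClosure L
  rw [maxIdeal, IsLocalRing.jacobson_eq_maximalIdeal ⊥ bot_ne_top]
  ext x
  rw [IsLocalRing.mem_maximalIdeal, mem_nonunits_iff, hv.not_isUnit_iff,
    Ideal.mem_span_singleton, hv.dvd_iff]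
  exact ⟨h.map_le_of_lt_one (x : L).2, fun hx ↦ hx.trans_lt h.map_lt_one⟩

lemma mem_maxIdeal_pow_iff (h : IsUniformizer v L π) (hv : IsNormalized A K v) (m : ℕ)
    (x : integralClosure A L) : x ∈ maxIdeal A L ^ m ↔ v ((x : L) : Ω) ≤ v π ^ m := by
  rw [h.maxIdeal_eq hv, Ideal.span_singleton_pow, Ideal.mem_span_singleton, hv.dvd_iff, ← map_pow]
  rfl

lemma irreducible_mkInteger (h : IsUniformizer v L π) (hv : IsNormalized A K v) :
    Irreducible (hv.mkInteger π h.mem h.map_lt_one.le) := by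
  refine ⟨hv.not_isUnit_iff.mpr h.map_lt_one, fun a b hab ↦ ?_⟩
  have hπ : v π = v ((a : L) : Ω) * v ((b : L) : Ω) := by
    rw [← map_mul]
    exact congrArg (fun y : integralClosure A L ↦ v ((y : L) : Ω)) hab
  by_contra! hcon
  rw [hv.not_isUnit_iff, hv.not_isUnit_iff] at hcon
  refine hπ.not_gt ?_
  calc v ((a : L) : Ω) * v ((b : L) : Ω) ≤ v π * v ((b : L) : Ω) := by
        gcongr
        exact h.map_le_of_lt_one (a : L).2 hcon.1
    _ < v π := mul_lt_of_lt_one_right h.map_pos hcon.2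

end IsUniformizer

end Integers

section Gal

lemma coe_apply_mem_conj {K Ω : Type*} [Field K] [Field Ω] [Algebra K Ω] [IsGalois K Ω]
    {L : IntermediateField K Ω} (g : Gal(L/K)) (x : L) : (g x : Ω) ∈ conj K (x : Ω) :=
  (mem_conj_iff K).mpr ⟨g.liftNormal Ω, g.liftNormal_commutes Ω x⟩

lemma exists_apply_eq_of_mem_conj {K Ω : Type*} [Field K] [Field Ω] [Algebra K Ω] [IsGalois K Ω]
    {L : IntermediateField K Ω} [Normal K L] (x : L) {z : Ω} (hz : z ∈ conj K (x : Ω)) :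
    ∃ g : Gal(L/K), (g x : Ω) = z := by
  obtain ⟨σ, rfl⟩ := (mem_conj_iff K).mp hz
  exact ⟨σ.restrictNormal L, σ.restrictNormal_commutes L x⟩

variable {A K Ω : Type*} [CommRing A] [IsDomain A] [IsDiscreteValuationRing A]
  [IsAlgClosed (ResidueField A)] [Field K] [Field Ω] [Algebra A K] [Algebra K Ω]
  [IsGalois K Ω] [Algebra A Ω] [IsScalarTower A K Ω] {v : Valuation Ω ℝ≥0}
  {L : IntermediateField K Ω} [FiniteDimensional K L] {π : Ω}

namespace IsUniformizer

lemma mem_lowerGroup_iff (h : IsUniformizer v L π) (hv : IsNormalized A K v) (g : Gal(L/K))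
    (t : ℝ) : g ∈ lowerGroup A K L t ↔ v ((g ⟨π, h.mem⟩ : L) - π) ≤ v π ^ (⌈t⌉₊ + 1) := by
  refine ⟨fun hg ↦ (h.mem_maxIdeal_pow_iff hv _ _).mp (hg _ (h.irreducible_mkInteger hv)),
    fun hg p _ ↦ (h.mem_maxIdeal_pow_iff hv _ _).mpr (le_trans ?_ hg)⟩
  obtain ⟨f, hf⟩ := h.exists_aeval_eq hv (p : L).2 (hv.map_coe_le_one p)
  have hgf : ((g p : L) : Ω) = aeval ((g ⟨π, h.mem⟩ : L) : Ω) f := by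
    have hlift (y : L) : g.liftNormal Ω (y : Ω) = g y := g.liftNormal_commutes Ω y
    rw [← hlift, ← hlift, ← hf, algEquiv_aeval]
  change v ((g p : L) - (p : L)) ≤ _
  rw [hgf, ← hf]
  exact hv.map_aeval_sub_aeval_le f
    ((hv.map_conj (coe_apply_mem_conj g ⟨π, h.mem⟩)).trans_le h.map_lt_one.le) h.map_lt_one.le

lemma apply_eq_iff (h : IsUniformizer v L π) (hv : IsNormalized A K v) {g g' : Gal(L/K)} :
    (g ⟨π, h.mem⟩ : Ω) = g' ⟨π, h.mem⟩ ↔ g = g' := by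
  refine ⟨fun hg ↦ ?_, fun hg ↦ hg ▸ rfl⟩
  refine AlgEquiv.coe_toAlgHom_injective
    (IntermediateField.algHom_ext_of_eq_adjoin K (h.adjoin_eq hv).symm fun x hx ↦ ?_)
  obtain rfl : x = π := hx
  exact Subtype.ext hg

lemma apply_eq_self_iff (h : IsUniformizer v L π) (hv : IsNormalized A K v) {g : Gal(L/K)} :
    (g ⟨π, h.mem⟩ : Ω) = π ↔ g = 1 := h.apply_eq_iff hv (g' := 1)

lemma conductor_eq_phi (h : IsUniformizer v L π) (hv : IsNormalized A K v) {g₀ : Gal(L/K)}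
    (hg₀ : g₀ ≠ 1) {N : ℕ} (hN : v ((g₀ ⟨π, h.mem⟩ : L) - π) = v π ^ (N + 1))
    (hmin : ∀ g : Gal(L/K), g ≠ 1 → v π ^ (N + 1) ≤ v ((g ⟨π, h.mem⟩ : L) - π)) :
    conductor A K L = phi A K L N := by
  refine Ramification.conductor_eq_phi A K L N.cast_nonneg fun t _ ↦ ?_
  have hiff : v π ^ (N + 1) ≤ v π ^ (⌈t⌉₊ + 1) ↔ t ≤ N := by
    rw [pow_le_pow_iff_right_of_lt_one₀ h.map_pos h.map_lt_one, Nat.add_le_add_iff_right,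
      Nat.ceil_le]
  rw [← hiff, Subgroup.ne_bot_iff_exists_ne_one]
  refine ⟨?_, fun hle ↦ ?_⟩
  · rintro ⟨⟨g, hg⟩, hg1⟩
    exact (hmin g fun h1 ↦ hg1 (Subtype.ext h1)).trans ((h.mem_lowerGroup_iff hv g t).mp hg)
  · exact ⟨⟨g₀, (h.mem_lowerGroup_iff hv g₀ t).mpr (hN.trans_le hle)⟩,
      fun h1 ↦ hg₀ (congrArg Subtype.val h1)⟩

variable [IsGalois K L]

lemma prod_conj_eq_prod_gal {M : Type*} [CommMonoid M] (h : IsUniformizer v L π)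
    (hv : IsNormalized A K v) (f : Ω → M) :
    ∏ z ∈ conj K π, f z = ∏ g : Gal(L/K), f (g ⟨π, h.mem⟩) := by
  refine (Finset.prod_bij (fun g _ ↦ (g ⟨π, h.mem⟩ : Ω))
    (fun g _ ↦ coe_apply_mem_conj g ⟨π, h.mem⟩)
    (fun g _ g' _ hg ↦ (h.apply_eq_iff hv).mp hg) (fun z hz ↦ ?_) (fun _ _ ↦ rfl)).symm
  obtain ⟨g, hg⟩ := exists_apply_eq_of_mem_conj ⟨π, h.mem⟩ hz
  exact ⟨g, Finset.mem_univ g, hg⟩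

lemma card_lowerGroup_zero (h : IsUniformizer v L π) (hv : IsNormalized A K v) :
    Nat.card (lowerGroup A K L 0) = Module.finrank K L := by
  have htop : lowerGroup A K L 0 = ⊤ := by
    refine (Subgroup.eq_top_iff' _).mpr fun g ↦ (h.mem_lowerGroup_iff hv g 0).mpr ?_
    simpa using v.map_sub_le (hv.map_conj (coe_apply_mem_conj g ⟨π, h.mem⟩)).le le_rfl
  rw [htop, Subgroup.card_top, IsGalois.card_aut_eq_finrank]

lemma herbrand_pow (h : IsUniformizer v L π) (hv : IsNormalized A K v) (N : ℕ) :
    herbrand K v π (v π ^ N) = v π ^ ∑ j ∈ Finset.range N, Nat.card (lowerGroup A K L j) := by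
  classical
  induction N with
  | zero =>
    refine Finset.prod_eq_one fun z hz ↦ ?_
    rw [pow_zero, max_eq_right (v.map_sub_le _ h.map_lt_one.le)]
    exact (hv.map_conj hz).trans_le h.map_lt_one.le
  | succ N ih =>
    have hstep (g : Gal(L/K)) : max (v (g ⟨π, h.mem⟩ - π)) (v π ^ (N + 1)) =
        max (v (g ⟨π, h.mem⟩ - π)) (v π ^ N) * if g ∈ lowerGroup A K L N then v π else 1 := by
      rw [h.max_map_pow_succ (sub_mem (g _).2 h.mem)]
      simp only [h.mem_lowerGroup_iff hv, Nat.ceil_natCast]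
    rw [Finset.sum_range_succ, pow_add (v π) (∑ _ ∈ _, _), ← ih, herbrand, herbrand,
      h.prod_conj_eq_prod_gal hv, h.prod_conj_eq_prod_gal hv,
      Finset.prod_congr rfl fun g _ ↦ hstep g, Finset.prod_mul_distrib, Finset.prod_ite,
      Finset.prod_const, Finset.prod_const_one, mul_one, ← Fintype.card_subtype,
      ← Nat.card_eq_fintype_card]

lemma herbrand_pow_succ_eq_rpow_phi (h : IsUniformizer v L π) (hv : IsNormalized A K v) (N : ℕ) :
    herbrand K v π (v π ^ (N + 1)) = (2 : ℝ≥0) ^ (-(phi A K L N + 1)) := by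
  have he : (Module.finrank K L : ℝ) ≠ 0 := Nat.cast_ne_zero.mpr Module.finrank_pos.ne'
  have hsum : (phi A K L N + 1) * Module.finrank K L =
      (∑ j ∈ Finset.range (N + 1), Nat.card (lowerGroup A K L j) : ℕ) := by
    rw [phi_natCast, Finset.sum_range_succ', Nat.cast_zero, h.card_lowerGroup_zero hv,
      ← Finset.sum_div, add_mul, one_mul, div_mul_cancel₀ _ he]
    push_cast
    rfl
  rw [h.herbrand_pow hv, h.pow_eq_rpow hv, ← hsum, mul_div_cancel_right₀ _ he]

end IsUniformizer

theorem IsNormalized.conductor_eq [IsGalois K L] (hv : IsNormalized A K v) {h : ℝ}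
    (hLE : BreaksLE v L h) (hGE : HasBreakGE v L h) : conductor A K L = h := by
  classical
  obtain ⟨π, hπ⟩ := hv.exists_isUniformizer L
  obtain ⟨z, hz, hzπ, hle⟩ := hGE π hπ
  obtain ⟨z₀, hz₀, hmin⟩ := Finset.exists_min_image ((conj K π).erase π) (fun w ↦ v (w - π))
    ⟨z, Finset.mem_erase.mpr ⟨hzπ, hz⟩⟩
  obtain ⟨hz₀π, hz₀⟩ := Finset.mem_erase.mp hz₀
  obtain ⟨g₀, rfl⟩ := exists_apply_eq_of_mem_conj ⟨π, hπ.mem⟩ hz₀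
  obtain ⟨N, hN⟩ : ∃ N : ℕ, v ((g₀ ⟨π, hπ.mem⟩ : L) - π) = v π ^ (N + 1) :=
    hπ.exists_map_eq_pow_succ (sub_mem (g₀ _).2 hπ.mem) (sub_ne_zero.mpr hz₀π)
      (v.map_sub_lt ((hv.map_conj hz₀).trans_lt hπ.map_lt_one) hπ.map_lt_one)
  rw [hN] at hmin
  have hcond : conductor A K L = phi A K L N := by
    refine hπ.conductor_eq_phi hv (mt (hπ.apply_eq_self_iff hv).mpr hz₀π) hN fun g hg ↦ ?_
    exact hmin _ (Finset.mem_erase.mpr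
      ⟨mt (hπ.apply_eq_self_iff hv).mp hg, coe_apply_mem_conj g ⟨π, hπ.mem⟩⟩)
  have hherb : (2 : ℝ≥0) ^ (-(h + 1)) = 2 ^ (-(phi A K L N + 1)) := by
    rw [← hπ.herbrand_pow_succ_eq_rpow_phi hv]
    exact le_antisymm (hN ▸ hLE π hπ _ hz₀ hz₀π)
      ((herbrand_mono π (hmin z (Finset.mem_erase.mpr ⟨hzπ, hz⟩))).trans hle)
  rw [hcond]
  linarith [(NNReal.rpow_right_inj two_ne_zero one_lt_two.ne').mp hherb]

end Gal

/-! ### The criterion of Fontaine -/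

section ApproximateConjugates

/-- The assignment `π ↦ β` defines a homomorphism from `A[π]` to the valuation ring of `v` modulo
the ideal of elements of value at most `r`. -/
structure IsApproxConj (A : Type*) {Ω : Type*} [CommRing A] [Field Ω] [Algebra A Ω]
    (v : Valuation Ω ℝ≥0) (r : ℝ≥0) (π β : Ω) : Prop where
  map_le_one : v β ≤ 1
  map_aeval_le (G : A[X]) : aeval π G = 0 → v (aeval β G) ≤ r

lemma IsApproxConj.of_le {A Ω : Type*} [CommRing A] [Field Ω] [Algebra A Ω] {v : Valuation Ω ℝ≥0}
    {r r' : ℝ≥0} {π β : Ω} (h : IsApproxConj A v r π β) (hr : r ≤ r') : IsApproxConj A v r' π β :=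
  ⟨h.map_le_one, fun G hG ↦ (h.map_aeval_le G hG).trans hr⟩

section

variable {A K Ω : Type*} [CommRing A] [Field K] [Field Ω] [Algebra A K] [Algebra K Ω]
  [IsGalois K Ω] {v : Valuation Ω ℝ≥0} {π β : Ω}

namespace IsNormalized

lemma isApproxConj [Algebra A Ω] [IsScalarTower A K Ω] (hv : IsNormalized A K v) (hπ : v π ≤ 1)
    (hβ : v β ≤ 1) : IsApproxConj A v (v (aeval β (minpoly K π))) π β := by
  refine ⟨hβ, fun G hG ↦ ?_⟩
  obtain ⟨P, hP, hPπ⟩ := hv.exists_map_eq_minpoly hπ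
  have hdvd : P ∣ G := by
    have := hv.integers.isFractionRing
    rw [← map_dvd_map _ (IsFractionRing.injective A K) hP, hPπ]
    exact minpoly.dvd K π (by rwa [aeval_map_algebraMap])
  obtain ⟨Q, rfl⟩ := hdvd
  rw [← hPπ, aeval_map_algebraMap, map_mul, map_mul]
  exact mul_le_of_le_one_right' (hv.map_aeval_le_one _ hβ)

lemma map_aeval_minpoly_eq_herbrand (hv : IsNormalized A K v) {z₁ : Ω} (hz₁ : z₁ ∈ conj K π)
    (hmin : ∀ z ∈ conj K π, v (z₁ - β) ≤ v (z - β)) :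
    v (aeval β (minpoly K π)) = herbrand K v π (v (z₁ - β)) := by
  obtain ⟨σ, rfl⟩ := (mem_conj_iff K).mp hz₁
  rw [aeval_minpoly_eq_prod_conj, map_prod, herbrand]
  refine (Finset.prod_bij (fun z _ ↦ σ z) (fun z hz ↦ apply_mem_conj K σ hz)
    (fun _ _ _ _ h ↦ σ.injective h)
    (fun z hz ↦ ⟨σ.symm z, apply_mem_conj K σ.symm hz, by simp⟩) fun z hz ↦ ?_).symm
  rw [v.map_sub_swap β, map_sub_eq_max v (hmin _ (apply_mem_conj K σ hz)), ← map_sub σ,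
    hv.map_algEquiv]

end IsNormalized

end

variable {A K Ω : Type*} [CommRing A] [IsDomain A] [IsDiscreteValuationRing A]
  [IsAlgClosed (ResidueField A)] [Field K] [Field Ω] [Algebra A K] [Algebra K Ω]
  [IsGalois K Ω] [Algebra A Ω] [IsScalarTower A K Ω] {v : Valuation Ω ℝ≥0}
  {L : IntermediateField K Ω} [FiniteDimensional K L] {π β : Ω}

namespace IsUniformizer

/-- Such a `β` arises as a root of the Eisenstein polynomial `minpoly K π - ϖ ^ q * X ^ s`. -/
lemma map_eq_of_map_aeval_minpoly_eq (h : IsUniformizer v L π) (hv : IsNormalized A K v) {q s : ℕ}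
    (hq : 2 ≤ q) (hs : s < Module.finrank K L)
    (hβ : v (aeval β (minpoly K π)) = 2⁻¹ ^ q * v β ^ s) : v β = v π := by
  have hq' : (2⁻¹ : ℝ≥0) ^ q < 2⁻¹ :=
    pow_lt_self_of_lt_one₀ (by norm_num) (by norm_num [inv_lt_one₀]) hq
  by_contra hne
  set M := max (v β) (v π)
  have hprod : v (aeval β (minpoly K π)) = M ^ Module.finrank K L := by
    rw [aeval_minpoly_eq_prod_conj, map_prod, ← h.natDegree_minpoly hv, ← card_conj,
      ← Finset.prod_const]
    refine Finset.prod_congr rfl fun z hz ↦ ?_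
    have hz' : v (-z) = v π := by rw [v.map_neg, hv.map_conj hz]
    rw [sub_eq_add_neg, v.map_add_of_distinct_val (hz' ▸ hne), hz']
  have hle : M ^ Module.finrank K L ≤ 2⁻¹ ^ q * M ^ s := by
    rw [← hprod, hβ]
    gcongr
    exact le_max_left _ _
  have hge : 2⁻¹ ≤ M ^ Module.finrank K L := by
    rw [← h.pow_finrank hv]
    gcongr
    exact le_max_right _ _
  obtain hM1 | hM1 := le_total M 1
  · exact hq'.not_ge ((hge.trans hle).trans (mul_le_of_le_one_right' (pow_le_one' hM1 s)))
  · refine (hle.trans_lt ?_).not_ge (pow_le_pow_right₀ hM1 hs.le)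
    exact mul_lt_of_lt_one_left (pow_pos (one_pos.trans_le hM1) s)
      (hq'.trans (by norm_num [inv_lt_one₀]))

lemma exists_map_aeval_minpoly_eq_pow [IsAlgClosed Ω] (h : IsUniformizer v L π)
    (hv : IsNormalized A K v) {r : ℕ} (hr : 2 * Module.finrank K L ≤ r) :
    ∃ β, v β ≤ 1 ∧ v (aeval β (minpoly K π)) = v π ^ r ∧
      Module.finrank K (K⟮β⟯) ≤ Module.finrank K L := by
  obtain ⟨ϖ, hϖ⟩ := IsDiscreteValuationRing.exists_irreducible A
  set e := Module.finrank K L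
  have he0 : 0 < e := Module.finrank_pos
  let R : K[X] := C (algebraMap A K ϖ ^ (r / e)) * X ^ (r % e)
  have hdeg : (minpoly K π - R).degree = e := by
    have hπdeg : (minpoly K π).degree = e := by
      rw [degree_eq_natDegree (minpoly.ne_zero (Algebra.IsIntegral.isIntegral π)),
        h.natDegree_minpoly hv]
    rw [← hπdeg]
    refine degree_sub_eq_left_of_degree_lt (hπdeg ▸ (degree_C_mul_X_pow_le _ _).trans_lt ?_)
    exact_mod_cast Nat.mod_lt r he0
  obtain ⟨β, hβ⟩ := IsAlgClosed.exists_aeval_eq_zero Ω (minpoly K π - R)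
    (hdeg ▸ Nat.cast_ne_zero.mpr he0.ne')
  have hvβ : v (aeval β (minpoly K π)) = 2⁻¹ ^ (r / e) * v β ^ (r % e) := by
    rw [map_sub, sub_eq_zero] at hβ
    simp only [hβ, R, map_mul, map_pow, aeval_C, aeval_X, ← IsScalarTower.algebraMap_apply,
      hv.map_algebraMap_irreducible hϖ]
  have hβπ := h.map_eq_of_map_aeval_minpoly_eq hv ((Nat.le_div_iff_mul_le he0).mpr hr)
    (Nat.mod_lt r he0) hvβ
  refine ⟨β, hβπ.trans_le h.map_lt_one.le, ?_, ?_⟩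
  · rw [hvβ, hβπ, ← h.pow_finrank hv, ← pow_mul, ← pow_add, Nat.div_add_mod]
  · rw [IntermediateField.adjoin.finrank (Algebra.IsIntegral.isIntegral β),
      ← natDegree_eq_of_degree_eq_some hdeg]
    refine natDegree_le_natDegree (minpoly.degree_le_of_ne_zero K β (fun h0 ↦ ?_) hβ)
    simp [h0] at hdeg

variable [IsGalois K L]

/-- `v π ^ n` lies strictly between the values of the Herbrand function at `v π ^ N` and at
`v π ^ (N + 1)`, which are apart because `lowerGroup A K L N` is nontrivial. -/
lemma map_aeval_minpoly_ne (h : IsUniformizer v L π) (hv : IsNormalized A K v) {N n : ℕ}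
    (hN : lowerGroup A K L N ≠ ⊥) (hn : herbrand K v π (v π ^ (N + 1)) = v π ^ (n + 1))
    (hβ : β ∈ L) : v (aeval β (minpoly K π)) ≠ v π ^ n := by
  have hpow (i j : ℕ) : v π ^ i ≤ v π ^ j ↔ j ≤ i :=
    pow_le_pow_iff_right_of_lt_one₀ h.map_pos h.map_lt_one
  have hpow' : Function.Injective (v π ^ · : ℕ → ℝ≥0) :=
    pow_right_injective₀ h.map_pos h.map_lt_one.ne
  intro hcon
  obtain ⟨z₁, hz₁, hmin⟩ := Finset.exists_min_image (conj K π) (fun z ↦ v (z - β))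
    ⟨π, self_mem_conj K π⟩
  rw [hv.map_aeval_minpoly_eq_herbrand hz₁ hmin] at hcon
  obtain hle | hgt := le_or_gt (v (z₁ - β)) (v π ^ (N + 1))
  · have := herbrand_mono (K := K) (v := v) π hle
    rw [hcon, hn, hpow] at this
    lia
  · obtain ⟨g, rfl⟩ := exists_apply_eq_of_mem_conj ⟨π, h.mem⟩ hz₁
    have hge := le_of_not_gt (mt (h.map_le_pow_succ_of_lt_pow (sub_mem (g _).2 hβ)) hgt.not_ge)
    have hherb := herbrand_mono (K := K) (v := v) π hge
    rw [hcon, h.herbrand_pow hv, hpow] at hherb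
    rw [h.herbrand_pow hv, hpow'.eq_iff, Finset.sum_range_succ] at hn
    have hcard := (Subgroup.one_lt_card_iff_ne_bot _).mpr hN
    lia

end IsUniformizer

/-- A criterion, due to Fontaine, for an upper bound on the upper ramification breaks: it suffices
that homomorphisms modulo `2 ^ m` from the valuation ring of `L` to that of another extension
can only exist if `L` embeds into that extension. -/
theorem BreaksLE.of_forall [IsAlgClosed Ω] [IsGalois K L] (hv : IsNormalized A K v) {m : ℝ}
    (hm : 2 ≤ m) (hme : ∃ j : ℕ, m * Module.finrank K L = j)
    (H : ∀ π β, IsUniformizer v L π → IsApproxConj A v (2 ^ (-m)) π β → L ≤ K⟮β⟯) :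
    BreaksLE v L (m - 1) := by
  intro π hπ z hz hzπ
  rw [sub_add_cancel]
  by_contra! hcon
  obtain ⟨j, hj⟩ := hme
  have hpow_j : v π ^ j = (2 : ℝ≥0) ^ (-m) := by
    rw [hπ.pow_eq_rpow hv, ← hj,
      mul_div_cancel_right₀ _ (Nat.cast_ne_zero.mpr Module.finrank_pos.ne')]
  obtain ⟨g, rfl⟩ := exists_apply_eq_of_mem_conj ⟨π, hπ.mem⟩ hz
  obtain ⟨N, hN⟩ := hπ.exists_map_eq_pow_succ (sub_mem (g _).2 hπ.mem) (sub_ne_zero.mpr hzπ)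
    (v.map_sub_lt ((hv.map_conj hz).trans_lt hπ.map_lt_one) hπ.map_lt_one)
  have hNbot : lowerGroup A K L N ≠ ⊥ := Subgroup.ne_bot_iff_exists_ne_one.mpr
    ⟨⟨g, (hπ.mem_lowerGroup_iff hv g N).mpr (by rw [Nat.ceil_natCast, hN])⟩,
      fun h1 ↦ hzπ ((hπ.apply_eq_self_iff hv).mpr (congrArg Subtype.val h1))⟩
  obtain ⟨n, hn, hjn⟩ : ∃ n, herbrand K v π (v π ^ (N + 1)) = v π ^ (n + 1) ∧ j ≤ n := by
    rw [hN, ← hpow_j, hπ.herbrand_pow hv,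
      pow_lt_pow_iff_right_of_lt_one₀ hπ.map_pos hπ.map_lt_one] at hcon
    refine ⟨_, ?_, Nat.le_sub_one_of_lt hcon⟩
    rw [hπ.herbrand_pow hv, Nat.sub_add_cancel (by lia)]
  have hrank : 2 * Module.finrank K L ≤ n := by
    refine le_trans ?_ hjn
    rw [← Nat.cast_le (α := ℝ), ← hj]
    push_cast
    gcongr
  obtain ⟨β, hβ1, hβ, hfin⟩ := hπ.exists_map_aeval_minpoly_eq_pow hv hrank
  have hle : L ≤ K⟮β⟯ := H π β hπ <| (hv.isApproxConj hπ.map_lt_one.le hβ1).of_le <| by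
    rw [hβ, ← hpow_j]
    exact pow_le_pow_right_of_le_one' hπ.map_lt_one.le hjn
  have := IntermediateField.adjoin.finiteDimensional
    (Algebra.IsIntegral.isIntegral (R := K) β)
  have hβL : β ∈ L := by
    rw [IntermediateField.eq_of_le_of_finrank_le hle hfin]
    exact IntermediateField.mem_adjoin_simple_self K β
  exact hπ.map_aeval_minpoly_ne hv hNbot hn hβL hβ

end ApproximateConjugates

/-! ### Roots of unity and dyadic valuations -/

section RootsOfUnity

lemma isPrimitiveRoot_two_pow_succ_iff {R : Type*} [CommRing R] [IsDomain R] [NeZero (2 : R)]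
    {ζ : R} {d : ℕ} : IsPrimitiveRoot ζ (2 ^ (d + 1)) ↔ ζ ^ 2 ^ d = -1 := by
  refine ⟨fun h ↦ (h.pow (by positivity) (pow_succ 2 d)).eq_neg_one_of_two_right, fun h ↦ ?_⟩
  have hne : (-1 : R) ≠ 1 := fun h1 ↦ two_ne_zero (α := R) (by linear_combination -h1)
  rw [IsPrimitiveRoot.iff_orderOf]
  refine orderOf_eq_prime_pow (h ▸ hne) ?_
  rw [pow_succ, pow_mul, h, neg_one_sq]

variable {K Ω : Type*} [Field K] [Field Ω] [Algebra K Ω] {E : IntermediateField K Ω} {N : ℕ}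
  [NeZero N] {ζ x y : Ω}

lemma mem_of_pow_eq_pow (hζ : IsPrimitiveRoot ζ N) (hζE : ζ ∈ E) (hy : y ∈ E)
    (h : x ^ N = y ^ N) : x ∈ E := by
  have hN : N ≠ 0 := NeZero.ne N
  obtain rfl | hy0 := eq_or_ne y 0
  · rw [zero_pow hN, pow_eq_zero_iff hN] at h
    exact h ▸ zero_mem E
  · obtain ⟨j, -, hj⟩ := hζ.eq_pow_of_pow_eq_one (ξ := x / y) (by
      rw [div_pow, h, div_self (pow_ne_zero N hy0)])
    rw [← div_mul_cancel₀ x hy0, ← hj]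
    exact mul_mem (pow_mem hζE j) hy

lemma adjoin_pair_le_iff : K⟮x, y⟯ ≤ E ↔ x ∈ E ∧ y ∈ E :=
  adjoin_le_iff.trans Set.pair_subset_iff

lemma adjoin_pair_le_of_pow_eq {ζ' : Ω} (hζ : ζ ^ N = 1) (hζ' : IsPrimitiveRoot ζ' N)
    (hζE : ζ' ∈ E) (hy : y ∈ E) (h : x ^ N = y ^ N) : K⟮ζ, x⟯ ≤ E :=
  adjoin_pair_le_iff.mpr ⟨mem_of_pow_eq_pow hζ' hζE (one_mem E) (by rw [hζ, one_pow]),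
    mem_of_pow_eq_pow hζ' hζE hy h⟩

instance finiteDimensional_adjoin_simple [Algebra.IsAlgebraic K Ω] (x : Ω) :
    FiniteDimensional K K⟮x⟯ :=
  adjoin.finiteDimensional (Algebra.IsIntegral.isIntegral x)

instance finiteDimensional_adjoin_pair [Algebra.IsAlgebraic K Ω] (x y : Ω) :
    FiniteDimensional K K⟮x, y⟯ :=
  finiteDimensional_adjoin fun z _ ↦ Algebra.IsIntegral.isIntegral z

lemma isGalois_adjoin_pair [IsGalois K Ω] (hζ : IsPrimitiveRoot ζ N) {a : K}
    (hx : x ^ N = algebraMap K Ω a) : IsGalois K K⟮ζ, x⟯ := by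
  have : Normal K K⟮ζ, x⟯ := by
    refine normal_iff_forall_map_le'.mpr fun σ ↦ ?_
    rw [adjoin_map, Set.image_pair]
    refine adjoin_pair_le_of_pow_eq (E := K⟮ζ, x⟯) ?_ hζ (mem_adjoin_pair_left K ζ x)
      (mem_adjoin_pair_right K ζ x) ?_
    · change σ ζ ^ N = 1
      rw [← map_pow, hζ.pow_eq_one, map_one]
    · change σ x ^ N = x ^ N
      rw [← map_pow, hx, AlgEquiv.commutes]
  exact ⟨⟩

end RootsOfUnity

lemma map_eq_one_of_pow_eq_one {R Γ : Type*} [Ring R] [LinearOrderedCommGroupWithZero Γ]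
    (v : Valuation R Γ) {N : ℕ} (hN : N ≠ 0) {x : R} (hx : v (x ^ N) = 1) : v x = 1 :=
  (pow_eq_one_iff_of_nonneg zero_le hN).mp (by rwa [map_pow] at hx)

lemma exists_sq_add_self_eq_and_map_le {F Γ : Type*} [Field F] [IsAlgClosed F]
    [LinearOrderedCommGroupWithZero Γ] (v : Valuation F Γ) {d : F} (hd : v d ≤ 1) :
    ∃ y : F, y ^ 2 + y = d ∧ v y ≤ v d := by
  have hdeg : (X ^ 2 + X - C d : Polynomial F).degree ≠ 0 := by
    have : (X ^ 2 + X - C d : Polynomial F).degree = 2 := by compute_degree!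
    simp [this]
  obtain ⟨y, hroot⟩ := IsAlgClosed.exists_aeval_eq_zero F _ hdeg
  have hy : y ^ 2 + y = d := by simpa [sub_eq_zero] using hroot
  have hmul : v y * v (y + 1) = v d := by
    rw [← map_mul, ← hy, mul_add_one, sq]
  rcases lt_trichotomy (v y) 1 with h | h | h
  · have hy1 : v (y + 1) = 1 := by
      rw [v.map_add_eq_of_lt_right (by rwa [map_one]), map_one]
    exact ⟨y, hy, by rw [← hmul, hy1, mul_one]⟩
  · refine ⟨-(y + 1), by rw [← hy]; ring, ?_⟩
    rw [v.map_neg, ← hmul, h, one_mul]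
  · have hy1 : v (y + 1) = v y := v.map_add_eq_of_lt_left (by rwa [map_one])
    rw [hy1] at hmul
    exact absurd hd (hmul ▸ one_lt_mul'' h h).not_ge

/-- A normalized valuation for which `2` is a uniformizer of the base ring. -/
structure IsDyadic (A K : Type*) {Ω : Type*} [CommRing A] [Field K] [Field Ω] [Algebra A K]
    [Algebra K Ω] (v : Valuation Ω ℝ≥0) : Prop extends IsNormalized A K v where
  irreducible_two : Irreducible (2 : A)

namespace IsDyadic

section

variable {A K Ω : Type*} [CommRing A] [Field K] [Field Ω] [Algebra A K] [Algebra K Ω]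
  {v : Valuation Ω ℝ≥0}

lemma map_two (hv : IsDyadic A K v) : v 2 = 2⁻¹ := by
  simpa only [map_ofNat] using hv.map_irreducible hv.irreducible_two

lemma map_two_lt_one (hv : IsDyadic A K v) : v 2 < 1 :=
  hv.map_two.trans_lt (by norm_num [inv_lt_one₀])

lemma neZero_two (hv : IsDyadic A K v) : NeZero (2 : Ω) :=
  ⟨v.ne_zero_iff.mp (by rw [hv.map_two]; norm_num)⟩

end

variable {A K Ω : Type*} [CommRing A] [IsDomain A] [IsDiscreteValuationRing A]
  [IsAlgClosed (ResidueField A)] [Field K] [Field Ω] [Algebra A K] [Algebra K Ω]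
  [IsGalois K Ω] [Algebra A Ω] [IsScalarTower A K Ω] {v : Valuation Ω ℝ≥0}

lemma mem_of_sq_add_self_mem (hv : IsDyadic A K v) (E : IntermediateField K Ω) {y : Ω}
    (hy : v y ≤ 1) (hE : y ^ 2 + y ∈ E) : y ∈ E := by
  rw [← InfiniteGalois.fixedField_fixingSubgroup E, mem_fixedField_iff]
  intro τ hτ
  have hroot : (τ y - y) * (τ y + y + 1) = 0 := by
    have := (mem_fixingSubgroup_iff E τ).mp hτ _ hE
    rw [map_add, map_pow] at this
    linear_combination this
  -- `y` has the same residue as an element of `A`, hence as its conjugate `τ y`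
  have hlt : v (τ y - y) < 1 := by
    obtain ⟨a, ha⟩ := hv.exists_map_sub_lt_one hy
    have ha' : v (τ y - algebraMap A Ω a) < 1 := by
      rwa [← hv.map_algEquiv τ, map_sub, IsScalarTower.algebraMap_apply A K Ω, AlgEquiv.commutes,
        ← IsScalarTower.algebraMap_apply] at ha
    simpa only [sub_sub_sub_cancel_right] using v.map_sub_lt ha' ha
  rcases mul_eq_zero.mp hroot with h | h
  · exact sub_eq_zero.mp h
  · have h2 : v (2 * y) < v 1 := by
      rw [map_mul, map_one]
      exact (mul_le_of_le_one_right' hy).trans_lt hv.map_two_lt_one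
    have h1 : v (τ y - y) = 1 := by
      rw [show τ y - y = -(1 + 2 * y) by linear_combination h, v.map_neg,
        v.map_add_eq_of_lt_left h2, map_one]
    exact absurd h1 hlt.ne

variable [IsAlgClosed Ω]

lemma exists_pow_two_pow_eq_of_map_sub_one_le (hv : IsDyadic A K v) (E : IntermediateField K Ω)
    (n : ℕ) {w : Ω} (hw : w ∈ E) (hw1 : v (w - 1) ≤ 2⁻¹ ^ (n + 1)) :
    ∃ t ∈ E, t ^ 2 ^ n = w := by
  have := hv.neZero_two
  induction n generalizing w with
  | zero => exact ⟨w, hw, by simp⟩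
  | succ n ih =>
    have hd : v ((w - 1) / 2 ^ 2) ≤ 2⁻¹ ^ n := by
      rwa [map_div₀, map_pow, hv.map_two, div_le_iff₀ (by positivity), ← pow_add]
    have hd1 : v ((w - 1) / 2 ^ 2) ≤ 1 := hd.trans (pow_le_one' (by norm_num [inv_le_one₀]) n)
    obtain ⟨y, hyd, hvy⟩ := exists_sq_add_self_eq_and_map_le v hd1
    have hy : y ∈ E := by
      refine hv.mem_of_sq_add_self_mem E (hvy.trans hd1) ?_
      rw [hyd]
      exact div_mem (sub_mem hw (one_mem E)) (pow_mem (ofNat_mem E 2) 2)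
    have hy2 : (1 + 2 * y) ^ 2 = w := by
      rw [eq_div_iff (pow_ne_zero 2 two_ne_zero)] at hyd
      linear_combination hyd
    obtain ⟨t, ht, htw⟩ := ih (add_mem (one_mem E) (mul_mem (ofNat_mem E 2) hy)) (by
      rw [add_sub_cancel_left, map_mul, hv.map_two, pow_succ']
      gcongr
      exact hvy.trans hd)
    exact ⟨t, ht, by rw [pow_succ, pow_mul, htw, hy2]⟩

lemma exists_pow_two_pow_eq (hv : IsDyadic A K v) (E : IntermediateField K Ω) (n : ℕ) {z u : Ω}
    (hz : z ∈ E) (hu : u ∈ E) (hu0 : u ≠ 0) (h : v (z ^ 2 ^ n - u) ≤ 2⁻¹ ^ (n + 1) * v u) :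
    ∃ t ∈ E, t ^ 2 ^ n = u := by
  obtain ⟨t, ht, htw⟩ := hv.exists_pow_two_pow_eq_of_map_sub_one_le E n
    (w := z ^ 2 ^ n / u) (div_mem (pow_mem hz _) hu) (by
      rwa [div_sub_one hu0, map_div₀, div_le_iff₀ (v.pos_iff.mpr hu0)])
  have hz0 : z ^ 2 ^ n ≠ 0 := by
    intro h0
    rw [h0, zero_sub, v.map_neg] at h
    refine absurd h (mul_lt_of_lt_one_left (v.pos_iff.mpr hu0) ?_).not_ge
    exact pow_lt_one₀ (by positivity) (by norm_num [inv_lt_one₀]) (Nat.succ_ne_zero n)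
  exact ⟨z / t, div_mem hz ht, by rw [div_pow, htw, div_div_cancel₀ hz0]⟩

end IsDyadic

/-! ### Upper bounds for radical extensions -/

section RadicalUpperBounds

lemma two_rpow_neg_natCast (n : ℕ) : (2 : ℝ≥0) ^ (-(n : ℝ)) = 2⁻¹ ^ n := by
  rw [NNReal.rpow_neg, NNReal.rpow_natCast, inv_pow]

lemma one_add_pow_four {R : Type*} [CommRing R] {i : R} (hi : i ^ 2 = -1) : (1 + i) ^ 4 = -4 := by
  linear_combination (i ^ 2 + 4 * i + 5) * hi

lemma BreaksLE.of_le_bot {K Ω : Type*} [Field K] [Field Ω] [Algebra K Ω] [IsGalois K Ω]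
    (v : Valuation Ω ℝ≥0) {L : IntermediateField K Ω} (hL : L ≤ ⊥) (h : ℝ) : BreaksLE v L h := by
  intro x hx z hz hzx
  obtain ⟨σ, rfl⟩ := (mem_conj_iff K).mp hz
  obtain ⟨a, rfl⟩ := mem_bot.mp (hL hx.mem)
  exact absurd (σ.commutes a) hzx

lemma IsApproxConj.map_pow_sub_le {A Ω : Type*} [CommRing A] [Field Ω] [Algebra A Ω]
    {v : Valuation Ω ℝ≥0} {r : ℝ≥0} {π β : Ω} (h : IsApproxConj A v r π β) {N : ℕ} {a : A}
    (hπ : π ^ N = algebraMap A Ω a) : v (β ^ N - algebraMap A Ω a) ≤ r := by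
  have haeval : v (aeval β (X ^ N - C a)) ≤ r := h.map_aeval_le _ (by simp [hπ])
  simpa using haeval

namespace IsDyadic

section

variable {A K Ω : Type*} [CommRing A] [Field K] [Field Ω] [Algebra A K] [Algebra K Ω]
  {v : Valuation Ω ℝ≥0} {i : Ω}

lemma map_one_add_sq (hv : IsDyadic A K v) (hi : i ^ 2 = -1) : v (1 + i) ^ 2 = 2⁻¹ := by
  have hi1 : v i = 1 := map_eq_one_of_pow_eq_one v two_ne_zero (by rw [hi, v.map_neg, map_one])
  rw [← map_pow, show (1 + i) ^ 2 = 2 * i by linear_combination hi, map_mul, hi1, mul_one,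
    hv.map_two]

lemma one_add_ne_zero (hv : IsDyadic A K v) (hi : i ^ 2 = -1) : 1 + i ≠ 0 := by
  refine v.ne_zero_iff.mp fun h ↦ ?_
  simpa [h] using hv.map_one_add_sq hi

lemma map_one_add (hv : IsDyadic A K v) (hi : i ^ 2 = -1) :
    v (1 + i) = (2 : ℝ≥0) ^ (-(1 / 2) : ℝ) := by
  refine (pow_left_inj₀ zero_le zero_le two_ne_zero).mp ?_
  rw [hv.map_one_add_sq hi, ← NNReal.rpow_natCast (2 ^ _), ← NNReal.rpow_mul, ← NNReal.rpow_neg_one]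
  norm_num

lemma map_sub_le_or_map_add_le (hv : IsDyadic A K v) (hi : i ^ 2 = -1) {y : Ω} {r : ℝ≥0}
    (hr : r < 2⁻¹ ^ 2) (hy : v (y ^ 2 + 1) ≤ r) : v (y - i) ≤ 2 * r ∨ v (y + i) ≤ 2 * r := by
  have map_sub_le_of_lt (j : Ω) (hj : j ^ 2 = -1) (hlt : v (y - j) < 2⁻¹) :
      v (y - j) ≤ 2 * r := by
    have hj1 : v (2 * j) = 2⁻¹ := by
      rw [map_mul, hv.map_two,
        map_eq_one_of_pow_eq_one v two_ne_zero (by rw [hj, v.map_neg, map_one]), mul_one]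
    have hadd : v (y + j) = 2⁻¹ := by
      rw [show y + j = (y - j) + 2 * j by ring, v.map_add_eq_of_lt_right (by rwa [hj1]), hj1]
    rw [show y ^ 2 + 1 = (y - j) * (y + j) by linear_combination hj, map_mul, hadd] at hy
    calc v (y - j) = 2 * (v (y - j) * 2⁻¹) := by field_simp
      _ ≤ 2 * r := by gcongr
  have hlt : v (y - i) < 2⁻¹ ∨ v (y + i) < 2⁻¹ := by
    by_contra! h
    refine hr.not_ge (le_trans ?_ hy)
    rw [show y ^ 2 + 1 = (y - i) * (y + i) by linear_combination hi, map_mul, sq]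
    exact mul_le_mul' h.1 h.2
  refine hlt.imp (map_sub_le_of_lt i hi) fun h ↦ ?_
  rw [← sub_neg_eq_add] at h ⊢
  exact map_sub_le_of_lt (-i) (by rwa [neg_sq]) h

end

variable {A K Ω : Type*} [CommRing A] [IsDomain A] [IsDiscreteValuationRing A]
  [Field K] [Field Ω] [Algebra A K] [Algebra K Ω] [IsGalois K Ω] {v : Valuation Ω ℝ≥0}

lemma even_finrank (hv : IsDyadic A K v) {i : Ω} (hi : i ^ 2 = -1) (L : IntermediateField K Ω)
    (hiL : i ∈ L) : Even (Module.finrank K L) := by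
  obtain ⟨n, hn⟩ := hv.exists_map_pow_finrank_eq L (add_mem (one_mem L) hiL)
    (hv.one_add_ne_zero hi)
  have hpow : (2 : ℝ≥0) ^ (n * 2) = 2 ^ (-(Module.finrank K L : ℤ)) := by
    rw [zpow_mul, ← hn, zpow_ofNat, ← pow_mul, mul_comm, pow_mul, hv.map_one_add_sq hi, zpow_neg,
      zpow_natCast, inv_pow]
  have hrank := zpow_right_injective₀ (by norm_num) (by norm_num) hpow
  exact (Int.even_coe_nat _).mp ⟨-n, by linarith⟩

lemma exists_pow_two_pow_eq_one_add [IsAlgClosed (ResidueField A)] [IsAlgClosed Ω] [Algebra A Ω]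
    [IsScalarTower A K Ω] (hv : IsDyadic A K v)
    {E : IntermediateField K Ω} {d : ℕ} {ζ z : Ω} (hζ : IsPrimitiveRoot ζ (2 ^ (d + 2)))
    (hζE : ζ ∈ E) (hz : z ∈ E)
    (hle : v ((z ^ 2 ^ d - 1) ^ 2 + 1) ≤ (2 : ℝ≥0) ^ (-(d + 5 / 2) : ℝ)) :
    ∃ t ∈ E, ∃ i, i ^ 2 = -1 ∧ t ^ 2 ^ d = 1 + i := by
  have := hv.neZero_two
  have hj : (ζ ^ 2 ^ d) ^ 2 = -1 := by
    rw [← pow_mul, ← pow_succ, isPrimitiveRoot_two_pow_succ_iff.mp hζ]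
  have hr : (2 : ℝ≥0) ^ (-(d + 5 / 2) : ℝ) < 2⁻¹ ^ 2 := by
    rw [← two_rpow_neg_natCast]
    refine NNReal.rpow_lt_rpow_of_exponent_lt one_lt_two ?_
    push_cast
    linarith [(Nat.cast_nonneg d : (0 : ℝ) ≤ d)]
  obtain ⟨i, hiE, hi, hclose⟩ : ∃ i ∈ E, i ^ 2 = -1 ∧
      v (z ^ 2 ^ d - 1 - i) ≤ 2 * 2 ^ (-(d + 5 / 2) : ℝ) := by
    rcases hv.map_sub_le_or_map_add_le hj hr hle with h | h
    · exact ⟨_, pow_mem hζE _, hj, h⟩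
    · exact ⟨_, neg_mem (pow_mem hζE _), by rwa [neg_sq], by rwa [sub_neg_eq_add]⟩
  obtain ⟨t, ht, hti⟩ := hv.exists_pow_two_pow_eq E d hz (add_mem (one_mem E) hiE)
    (hv.one_add_ne_zero hi) (by
      rw [← sub_sub, hv.map_one_add hi]
      refine hclose.trans_eq ?_
      rw [← two_rpow_neg_natCast, ← NNReal.rpow_add two_ne_zero, ← NNReal.rpow_one_add']
      · congr 1
        push_cast
        ring
      · linarith [(Nat.cast_nonneg d : (0 : ℝ) ≤ d)])
  exact ⟨t, ht, i, hi, hti⟩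

end IsDyadic

variable {A K Ω : Type*} [CommRing A] [IsDomain A] [IsDiscreteValuationRing A]
  [IsAlgClosed (ResidueField A)] [Field K] [Field Ω] [Algebra A K] [Algebra K Ω]
  [IsGalois K Ω] [Algebra A Ω] [IsScalarTower A K Ω] {v : Valuation Ω ℝ≥0}

namespace IsUniformizer

variable {L : IntermediateField K Ω} [FiniteDimensional K L] {π β : Ω} {r : ℝ≥0}

lemma exists_isApproxConj (h : IsUniformizer v L π) (hv : IsNormalized A K v)
    (hβ : IsApproxConj A v r π β) {x : Ω} (hx : x ∈ L) (hx1 : v x ≤ 1) :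
    ∃ x' ∈ K⟮β⟯, IsApproxConj A v r x x' := by
  obtain ⟨F, rfl⟩ := h.exists_aeval_eq hv hx hx1
  refine ⟨aeval β F, aeval_mem F (mem_adjoin_simple_self K β),
    hv.map_aeval_le_one F hβ.map_le_one, fun G hG ↦ ?_⟩
  rw [← aeval_comp] at hG ⊢
  exact hβ.map_aeval_le _ hG

lemma exists_isPrimitiveRoot [IsAlgClosed Ω] (h : IsUniformizer v L π) (hv : IsDyadic A K v)
    (hβ : IsApproxConj A v r π β) {c : ℕ} (hr : r ≤ 2⁻¹ ^ c) {ζ : Ω}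
    (hζ : IsPrimitiveRoot ζ (2 ^ c)) (hζL : ζ ∈ L) : ∃ ζ' ∈ K⟮β⟯, IsPrimitiveRoot ζ' (2 ^ c) := by
  cases c with
  | zero => exact ⟨1, one_mem _, by simp⟩
  | succ d =>
    have := hv.neZero_two
    have hζ1 : v ζ = 1 :=
      map_eq_one_of_pow_eq_one v (NeZero.ne (2 ^ (d + 1))) (by rw [hζ.pow_eq_one, map_one])
    rw [isPrimitiveRoot_two_pow_succ_iff] at hζ
    obtain ⟨z, hz, hζz⟩ := h.exists_isApproxConj hv.toIsNormalized hβ hζL hζ1.le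
    obtain ⟨t, ht, htp⟩ := hv.exists_pow_two_pow_eq K⟮β⟯ d hz (neg_mem (one_mem _))
      (neg_ne_zero.mpr one_ne_zero)
      (by
        simpa only [v.map_neg, map_neg, map_one, mul_one] using
          (hζz.map_pow_sub_le (a := -1) (by simp [hζ])).trans hr)
    exact ⟨t, ht, isPrimitiveRoot_two_pow_succ_iff.mpr htp⟩

end IsUniformizer

namespace BreaksLE

variable [IsAlgClosed Ω]

theorem adjoin_root_unit (hv : IsDyadic A K v) {d : ℕ} {ζ x : Ω}
    (hζ : IsPrimitiveRoot ζ (2 ^ (d + 1))) {u : A} (hu : IsUnit u)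
    (hx : x ^ 2 ^ d = algebraMap A Ω u) : BreaksLE v K⟮ζ, x⟯ d := by
  have hu1 : v (algebraMap A Ω u) = 1 := hv.map_algebraMap_eq_one_iff.mpr hu
  have hxc : x ^ 2 ^ (d + 1) = algebraMap K Ω (algebraMap A K u ^ 2) := by
    rw [pow_succ, pow_mul, hx, map_pow, ← IsScalarTower.algebraMap_apply]
  have := hv.neZero_two
  obtain rfl | hd := Nat.eq_zero_or_pos d
  · refine of_le_bot v (adjoin_pair_le_iff.mpr ⟨?_, ?_⟩) _
    · rw [isPrimitiveRoot_two_pow_succ_iff, pow_zero, pow_one] at hζ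
      exact hζ ▸ neg_mem (one_mem _)
    · rw [pow_zero, pow_one] at hx
      exact hx ▸ algebraMap_mem ⊥ u
  have := isGalois_adjoin_pair hζ hxc
  rw [← add_sub_cancel_right (d : ℝ) 1, ← Nat.cast_succ]
  refine of_forall hv.toIsNormalized (by exact_mod_cast Nat.succ_le_succ hd)
    ⟨_, (Nat.cast_mul _ _).symm⟩ fun π β hπ hβ ↦ ?_
  rw [two_rpow_neg_natCast] at hβ
  obtain ⟨ζ', hζ', hζp⟩ := hπ.exists_isPrimitiveRoot hv hβ le_rfl hζ (mem_adjoin_pair_left K ζ x)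
  have hx1 : v x = 1 := map_eq_one_of_pow_eq_one v (NeZero.ne (2 ^ d)) (by rw [hx, hu1])
  obtain ⟨z, hz, hxz⟩ :=
    hπ.exists_isApproxConj hv.toIsNormalized hβ (mem_adjoin_pair_right K ζ x) hx1.le
  obtain ⟨t, ht, htp⟩ := hv.exists_pow_two_pow_eq K⟮β⟯ d hz (algebraMap_mem _ u)
    (v.ne_zero_iff.mp (by simp [hu1]))
    (by rw [hu1, mul_one]; exact hxz.map_pow_sub_le hx)
  refine adjoin_pair_le_of_pow_eq hζ.pow_eq_one hζp hζ' ht ?_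
  rw [pow_succ, pow_mul, pow_mul, hx, htp]

theorem adjoin_root_two (hv : IsDyadic A K v) {c : ℕ} {ζ x : Ω}
    (hζ : IsPrimitiveRoot ζ (2 ^ c)) (hx : x ^ 2 ^ c = 2) : BreaksLE v K⟮ζ, x⟯ (c + 1) := by
  have := isGalois_adjoin_pair hζ (hx.trans (map_ofNat (algebraMap K Ω) 2).symm)
  rw [show (c + 1 : ℝ) = (c + 2 : ℕ) - 1 by push_cast; ring]
  refine of_forall hv.toIsNormalized (by simp) ⟨_, (Nat.cast_mul _ _).symm⟩ fun π β hπ hβ ↦ ?_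
  rw [two_rpow_neg_natCast] at hβ
  obtain ⟨ζ', hζ', hζp⟩ := hπ.exists_isPrimitiveRoot hv hβ
    (pow_le_pow_right_of_le_one' (by norm_num [inv_le_one₀]) (by lia)) hζ
    (mem_adjoin_pair_left K ζ x)
  have hx1 : v x ≤ 1 := by
    rw [← pow_le_one_iff (NeZero.ne (2 ^ c)), ← map_pow, hx]
    exact hv.map_two_lt_one.le
  obtain ⟨z, hz, hxz⟩ :=
    hπ.exists_isApproxConj hv.toIsNormalized hβ (mem_adjoin_pair_right K ζ x) hx1
  obtain ⟨t, ht, htp⟩ := hv.exists_pow_two_pow_eq K⟮β⟯ c hz (ofNat_mem _ 2) hv.neZero_two.out (by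
    rw [hv.map_two, ← pow_succ]
    simpa only [map_ofNat] using hxz.map_pow_sub_le (a := 2) (by rw [hx, map_ofNat]))
  exact adjoin_pair_le_of_pow_eq hζ.pow_eq_one hζp hζ' ht (hx.trans htp.symm)

theorem adjoin_root_one_add (hv : IsDyadic A K v) {d : ℕ} {ζ x i : Ω}
    (hζ : IsPrimitiveRoot ζ (2 ^ (d + 2))) (hi : i ^ 2 = -1) (hx : x ^ 2 ^ d = 1 + i) :
    BreaksLE v K⟮ζ, x⟯ (d + 3 / 2) := by
  have hxc : x ^ 2 ^ (d + 2) = -4 := by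
    rw [pow_add, pow_mul, hx, show 2 ^ 2 = 4 by rfl, one_add_pow_four hi]
  have := isGalois_adjoin_pair (a := (-4 : K)) hζ (by rw [hxc, map_neg, map_ofNat])
  have hiL : i ∈ K⟮ζ, x⟯ := by
    rw [eq_sub_of_add_eq' hx.symm]
    exact sub_mem (pow_mem (mem_adjoin_pair_right K ζ x) _) (one_mem _)
  obtain ⟨e, he⟩ := hv.even_finrank hi _ hiL
  have hd : (0 : ℝ) ≤ d := d.cast_nonneg
  rw [show (d + 3 / 2 : ℝ) = d + 5 / 2 - 1 by ring]
  refine of_forall hv.toIsNormalized (by linarith [hd])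
    ⟨(2 * d + 5) * e, by rw [he]; push_cast; ring⟩ fun π β hπ hβ ↦ ?_
  have hr : (2 : ℝ≥0) ^ (-(d + 5 / 2) : ℝ) ≤ 2⁻¹ ^ (d + 2) := by
    rw [← two_rpow_neg_natCast]
    exact NNReal.rpow_le_rpow_of_exponent_le one_le_two (by push_cast; linarith [hd])
  obtain ⟨ζ', hζ', hζp⟩ := hπ.exists_isPrimitiveRoot hv hβ hr hζ (mem_adjoin_pair_left K ζ x)
  have hx1 : v x ≤ 1 := by
    rw [← pow_le_one_iff (NeZero.ne (2 ^ d)), ← map_pow, hx, hv.map_one_add hi]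
    exact NNReal.rpow_le_one_of_one_le_of_nonpos one_le_two (by norm_num)
  obtain ⟨z, hz, hxz⟩ :=
    hπ.exists_isApproxConj hv.toIsNormalized hβ (mem_adjoin_pair_right K ζ x) hx1
  obtain ⟨t, ht, i', hi', htp⟩ := hv.exists_pow_two_pow_eq_one_add hζp hζ' hz (by
    have haeval : v (aeval z ((X ^ 2 ^ d - 1) ^ 2 + 1 : A[X])) ≤ _ :=
      hxz.map_aeval_le _ (by simp [hx, hi])
    simpa using haeval)
  refine adjoin_pair_le_of_pow_eq hζ.pow_eq_one hζp hζ' ht ?_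
  rw [hxc, pow_add, pow_mul, htp, show 2 ^ 2 = 4 by rfl, one_add_pow_four hi']

end BreaksLE

end RadicalUpperBounds

/-! ### Lower bounds for radical extensions -/

lemma neg_pow_two_pow {R : Type*} [CommRing R] {d : ℕ} (hd : 1 ≤ d) (x : R) :
    (-x) ^ 2 ^ d = x ^ 2 ^ d :=
  (even_two.pow_of_ne_zero (Nat.one_le_iff_ne_zero.mp hd)).neg_pow x

lemma IsDyadic.map_sub_one_pow_of_pow_eq_neg_one {A K Ω : Type*} [CommRing A] [Field K] [Field Ω]
    [Algebra A K] [Algebra K Ω] {v : Valuation Ω ℝ≥0} (hv : IsDyadic A K v) (d : ℕ) {ζ : Ω}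
    (hζ : ζ ^ 2 ^ d = -1) : v (ζ - 1) ^ 2 ^ d = 2⁻¹ := by
  induction d generalizing ζ with
  | zero =>
    rw [pow_zero, pow_one] at hζ ⊢
    rw [hζ, show (-1 - 1 : Ω) = -2 by norm_num, v.map_neg, hv.map_two]
  | succ d ih =>
    have hsq : v (ζ ^ 2 - 1) ^ 2 ^ d = 2⁻¹ := ih (by rw [← pow_mul, ← pow_succ', hζ])
    have hfac : v (ζ ^ 2 - 1) = v (ζ - 1) * v (ζ + 1) := by
      rw [← map_mul]
      ring_nf
    have hlt : 2⁻¹ < v (ζ - 1) := by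
      by_contra! hle
      have hadd : v (ζ + 1) ≤ 2⁻¹ := by
        rw [show ζ + 1 = (ζ - 1) + 2 by ring]
        exact v.map_add_le hle hv.map_two.le
      have hsq_lt : v (ζ ^ 2 - 1) < 2⁻¹ := by
        rw [hfac]
        calc v (ζ - 1) * v (ζ + 1) ≤ 2⁻¹ * 2⁻¹ := mul_le_mul' hle hadd
          _ < 2⁻¹ := mul_lt_of_lt_one_left (by norm_num) (by norm_num [inv_lt_one₀])
      refine absurd hsq (LE.le.trans_lt ?_ hsq_lt).ne
      exact pow_le_of_le_one zero_le (hsq_lt.le.trans (by norm_num [inv_le_one₀]))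
        (NeZero.ne _)
    have hadd : v (ζ + 1) = v (ζ - 1) := by
      rw [show ζ + 1 = 2 + (ζ - 1) by ring, v.map_add_eq_of_lt_right (by rwa [hv.map_two])]
    rw [pow_succ', pow_mul, sq, ← hsq, hfac, hadd]

namespace HasBreakGE

variable {A K Ω : Type*} [CommRing A] [IsDomain A] [IsDiscreteValuationRing A]
  [IsAlgClosed (ResidueField A)] [Field K] [Field Ω] [Algebra A K] [Algebra K Ω]
  [IsGalois K Ω] [Algebra A Ω] [IsScalarTower A K Ω] {v : Valuation Ω ℝ≥0}

lemma of_eisenstein (hv : IsNormalized A K v) {x z : Ω} {P : K[X]} (hP : P.Monic)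
    (hx : aeval x P = 0) (hvx : v x ^ P.natDegree = 2⁻¹) (hz : aeval z P = 0) (hzx : z ≠ x) {h : ℝ}
    (hle : v (aeval x (derivative P) * (z - x)) ≤ (2 : ℝ≥0) ^ (-(h + 1))) :
    HasBreakGE v K⟮x⟯ h := by
  classical
  have hmin := hv.minpoly_eq_of_pow_natDegree hP hx hvx
  refine of_derivative hv (hv.isUniformizer_adjoin hP hx hvx) (z := z) ?_ hzx ?_
  · rw [conj, Multiset.mem_toFinset, mem_aroots, hmin]
    exact ⟨hP.ne_zero, hz⟩
  · rwa [hmin, ← map_mul]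

theorem adjoin_primitiveRoot (hv : IsDyadic A K v) {d : ℕ} (hd : 1 ≤ d) {ζ : Ω}
    (hζ : IsPrimitiveRoot ζ (2 ^ (d + 1))) : HasBreakGE v K⟮ζ⟯ d := by
  have := hv.neZero_two
  have hζ1 : v ζ = 1 := map_eq_one_of_pow_eq_one v (NeZero.ne _) (by rw [hζ.pow_eq_one, map_one])
  have hζ0 : ζ ≠ 0 := hζ.ne_zero (NeZero.ne _)
  have hN : (2 : ℕ) ^ d ≠ 0 := NeZero.ne _
  rw [isPrimitiveRoot_two_pow_succ_iff] at hζ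
  have hle : K⟮ζ - 1⟯ ≤ K⟮ζ⟯ :=
    adjoin_simple_le_iff.mpr (sub_mem (mem_adjoin_simple_self K ζ) (one_mem _))
  refine HasBreakGE.mono ?_ hv.toIsNormalized hle
  refine of_eisenstein hv.toIsNormalized (P := (X ^ 2 ^ d + C 1 : K[X]).comp (X + C 1))
    (z := -ζ - 1) ((monic_X_pow_add_C 1 hN).comp_X_add_C 1) (by simp [hζ]) ?_ ?_ ?_ ?_
  · rw [natDegree_comp, natDegree_X_pow_add_C, natDegree_X_add_C, mul_one,
      hv.map_sub_one_pow_of_pow_eq_neg_one d hζ]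
  · simp [neg_pow_two_pow hd, hζ]
  · intro h
    exact mul_ne_zero two_ne_zero hζ0 (by linear_combination -h)
  · have hval : aeval (ζ - 1) (derivative ((X ^ 2 ^ d + C 1 : K[X]).comp (X + C 1))) *
        (-ζ - 1 - (ζ - 1)) = 2 ^ (d + 1) := by
      have hpow := pow_sub_one_mul hN ζ
      rw [hζ] at hpow
      simp only [derivative_comp, map_mul, aeval_comp, derivative_X_pow, derivative_X,
        derivative_one, map_add, map_one, map_zero, aeval_X, map_natCast, map_pow]
      push_cast
      linear_combination -2 ^ (d + 1) * hpow
    rw [hval, map_pow, hv.map_two, ← two_rpow_neg_natCast]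
    push_cast
    rfl

lemma adjoin_root (hv : IsDyadic A K v) {d : ℕ} (hd : 1 ≤ d) {x : Ω} {Q : K[X]} (hQ : Q.Monic)
    (hx : aeval (x ^ 2 ^ d) Q = 0) (hvx : v (x ^ 2 ^ d) ^ Q.natDegree = 2⁻¹) {h : ℝ}
    (hle : v (2 ^ (d + 1) * x ^ 2 ^ d * aeval (x ^ 2 ^ d) (derivative Q)) ≤
      (2 : ℝ≥0) ^ (-(h + 1))) : HasBreakGE v K⟮x⟯ h := by
  have := hv.neZero_two
  have hN : (2 : ℕ) ^ d ≠ 0 := NeZero.ne _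
  have hx0 : x ≠ 0 := by
    rintro rfl
    rw [zero_pow hN, map_zero] at hvx
    obtain h | h := eq_or_ne Q.natDegree 0 <;> simp [h] at hvx
  refine of_eisenstein hv.toIsNormalized (P := expand K (2 ^ d) Q) (z := -x)
    (hQ.expand (Nat.two_pow_pos d)) (by rwa [expand_aeval])
    (by rwa [natDegree_expand, mul_comm, pow_mul, ← map_pow])
    (by rwa [expand_aeval, neg_pow_two_pow hd]) ?_ ?_
  · intro h
    exact mul_ne_zero two_ne_zero hx0 (by linear_combination -h)
  · refine Eq.trans_le ?_ hle
    rw [← v.map_neg, derivative_expand]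
    congr 1
    have hpow := pow_sub_one_mul hN x
    rw [map_mul, map_mul, expand_aeval, map_natCast, map_pow, aeval_X]
    push_cast
    linear_combination 2 ^ (d + 1) * aeval (x ^ 2 ^ d) (derivative Q) * hpow

theorem adjoin_root_two (hv : IsDyadic A K v) {c : ℕ} (hc : 1 ≤ c) {x : Ω}
    (hx : x ^ 2 ^ c = 2) : HasBreakGE v K⟮x⟯ (c + 1) := by
  refine adjoin_root hv hc (monic_X_sub_C 2) ?_ ?_ ?_
  · simp [hx, map_ofNat (algebraMap K Ω)]
  · rw [natDegree_X_sub_C, pow_one, hx, hv.map_two]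
  · rw [hx, derivative_X_sub_C, map_one, mul_one, ← pow_succ, map_pow, hv.map_two,
      ← two_rpow_neg_natCast]
    apply le_of_eq
    congr 1
    push_cast
    ring

theorem adjoin_root_one_add (hv : IsDyadic A K v) {d : ℕ} (hd : 1 ≤ d) {x i : Ω}
    (hi : i ^ 2 = -1) (hx : x ^ 2 ^ d = 1 + i) : HasBreakGE v K⟮x⟯ (d + 3 / 2) := by
  refine adjoin_root hv hd (Q := X ^ 2 - C 2 * X + C 2) ?_ ?_ ?_ ?_
  · monicity!
  · simp only [hx, map_add, map_sub, map_pow, aeval_X, map_mul, map_ofNat]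
    linear_combination hi
  · rw [show (X ^ 2 - C 2 * X + C 2 : K[X]).natDegree = 2 by compute_degree!, hx,
      hv.map_one_add_sq hi]
  · have hi1 : v i = 1 := map_eq_one_of_pow_eq_one v two_ne_zero (by rw [hi, v.map_neg, map_one])
    have hval : aeval (1 + i) (derivative (X ^ 2 - C 2 * X + C 2 : K[X])) = 2 * i := by
      simp only [map_add, map_sub, derivative_X_sq, derivative_mul, derivative_X, derivative_ofNat,
        map_mul, map_zero, map_one, aeval_X, map_ofNat]
      ring
    rw [hx, hval, map_mul, map_mul, map_mul, map_pow, hv.map_two, hv.map_one_add hi, hi1, mul_one,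
      ← two_rpow_neg_natCast, ← NNReal.rpow_neg_one, mul_right_comm, ← NNReal.rpow_add two_ne_zero,
      ← NNReal.rpow_add two_ne_zero]
    apply le_of_eq
    congr 1
    push_cast
    ring

end HasBreakGE

/-! ### Comparison of radicals -/

lemma mem_of_pow_mem_of_coprime {K Ω : Type*} [Field K] [Field Ω] [Algebra K Ω]
    {E : IntermediateField K Ω} {m N : ℕ} (h : m.Coprime N) {x : Ω} (hm : x ^ m ∈ E)
    (hN : x ^ N ∈ E) : x ∈ E := by
  obtain rfl | hx := eq_or_ne x 0
  · exact zero_mem E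
  · have hbezout : (x ^ m) ^ m.gcdA N * (x ^ N) ^ m.gcdB N = x := by
      rw [← zpow_natCast, ← zpow_natCast, ← zpow_mul, ← zpow_mul, ← zpow_add₀ hx,
        ← Nat.gcd_eq_gcd_ab, h, Nat.cast_one, zpow_one]
    exact hbezout ▸ mul_mem (zpow_mem hm _) (zpow_mem hN _)

lemma isUnit_of_dvd_sub_one {R : Type*} [CommRing R] [IsLocalRing R] {p b : R} (hp : ¬IsUnit p)
    (h : p ∣ b - 1) : IsUnit b :=
  isUnit_of_mem_nonunits_one_sub_self b fun hu ↦
    hp (isUnit_of_dvd_unit ((dvd_sub_comm).mp h) hu)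

lemma neg_two_pow_two_mul {R : Type*} [CommRing R] {m : ℕ} (hm : Odd m) (w : R) :
    -(2 ^ (2 * m) * w) = (-4) ^ m * w := by
  rw [hm.neg_pow, pow_mul, neg_mul]
  norm_num

lemma exists_isPrimitiveRoot_two_pow (F : Type*) [Field F] [IsAlgClosed F] [NeZero (2 : F)]
    (c : ℕ) : ∃ ζ : F, IsPrimitiveRoot ζ (2 ^ c) := by
  have : NeZero ((2 ^ c : ℕ) : F) := ⟨by simp [two_ne_zero]⟩
  exact HasEnoughRootsOfUnity.exists_primitiveRoot F (2 ^ c)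

lemma adjoin_pair_eq_bot {A K Ω : Type*} [CommRing A] [Field K] [Field Ω] [Algebra A K]
    [Algebra K Ω] [Algebra A Ω] [IsScalarTower A K Ω] {ζ α : Ω} (hζ : IsPrimitiveRoot ζ 2) {a : A}
    (hα : α ^ 2 = algebraMap A Ω (a ^ 2)) : K⟮ζ, α⟯ = ⊥ := by
  have ha : algebraMap A Ω a ∈ (⊥ : IntermediateField K Ω) :=
    IsScalarTower.algebraMap_apply A K Ω a ▸ algebraMap_mem ⊥ _
  rw [eq_bot_iff, adjoin_pair_le_iff, hζ.eq_neg_one_of_two_right]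
  refine ⟨neg_mem (one_mem _), ?_⟩
  rcases sq_eq_sq_iff_eq_or_eq_neg.mp (hα.trans (map_pow _ a 2)) with rfl | rfl
  · exact ha
  · exact neg_mem ha

section Kummer

variable {A K Ω : Type*} [CommRing A] [IsDomain A] [IsDiscreteValuationRing A]
  [IsAlgClosed (ResidueField A)] [Field K] [Field Ω] [Algebra A K] [Algebra K Ω]
  [IsGalois K Ω] [Algebra A Ω] [IsScalarTower A K Ω] {v : Valuation Ω ℝ≥0}

section AdjoinPair

variable {N m : ℕ} [NeZero N] {ζ ζ₁ ζ₂ α x z : Ω} {a b : A} {h h' : ℝ}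

lemma BreaksLE.adjoin_pair_of_pow_eq_mul (h₁ : BreaksLE v K⟮ζ₁, x⟯ h) (h₂ : BreaksLE v K⟮ζ₂, z⟯ h)
    (hv : IsNormalized A K v) (hζ : IsPrimitiveRoot ζ N) (hζL : ζ ∈ K⟮ζ₁, x⟯ ⊔ K⟮ζ₂, z⟯)
    (hx : x ^ N = algebraMap A Ω a) (hz : z ^ N = algebraMap A Ω b)
    (hα : α ^ N = algebraMap A Ω (a ^ m * b)) : BreaksLE v K⟮ζ, α⟯ h := by
  refine (h₁.sup h₂ hv).mono hv
    (adjoin_pair_le_of_pow_eq hζ.pow_eq_one hζ hζL (y := x ^ m * z) ?_ ?_)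
  · exact mul_mem
      (pow_mem ((le_sup_left : _ ≤ _ ⊔ K⟮ζ₂, z⟯) (mem_adjoin_pair_right K ζ₁ x)) m)
      ((le_sup_right : _ ≤ K⟮ζ₁, x⟯ ⊔ _) (mem_adjoin_pair_right K ζ₂ z))
  · rw [hα, mul_pow, pow_right_comm, hx, hz, map_mul, map_pow]

/- As the breaks of `K⟮ζ₂, z⟯` are small and `x ∈ K⟮ζ, α⟯ ⊔ K⟮ζ₂, z⟯`, the break of `K⟮x⟯` must
come from `K⟮ζ, α⟯`. -/
lemma HasBreakGE.adjoin_pair_of_pow_eq_mul (hGE : HasBreakGE v K⟮x⟯ h)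
    (h₂ : BreaksLE v K⟮ζ₂, z⟯ h') (hlt : h' < h) (hv : IsNormalized A K v)
    (hζ : IsPrimitiveRoot ζ N) (hm : m.Coprime N) (hz0 : z ≠ 0)
    (hx : x ^ N = algebraMap A Ω a) (hz : z ^ N = algebraMap A Ω b)
    (hα : α ^ N = algebraMap A Ω (a ^ m * b)) : HasBreakGE v K⟮ζ, α⟯ h := by
  have hxm : x ^ m ∈ K⟮ζ, α⟯ ⊔ K⟮ζ₂, z⟯ := by
    refine mem_of_pow_eq_pow (y := α / z) hζ
      ((le_sup_left : _ ≤ _ ⊔ K⟮ζ₂, z⟯) (mem_adjoin_pair_left K ζ α))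
      (div_mem ((le_sup_left : _ ≤ _ ⊔ K⟮ζ₂, z⟯) (mem_adjoin_pair_right K ζ α))
        ((le_sup_right : _ ≤ K⟮ζ, α⟯ ⊔ _) (mem_adjoin_pair_right K ζ₂ z))) ?_
    rw [div_pow, hα, map_mul, map_pow, ← hx, ← hz, mul_div_cancel_right₀ _ (pow_ne_zero N hz0),
      pow_right_comm]
  have hxN : x ^ N ∈ K⟮ζ, α⟯ ⊔ K⟮ζ₂, z⟯ := by
    rw [hx, IsScalarTower.algebraMap_apply A K Ω]
    exact algebraMap_mem _ _
  exact (hGE.mono hv (adjoin_simple_le_iff.mpr (mem_of_pow_mem_of_coprime hm hxm hxN))).of_sup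
    h₂ hlt hv

lemma IsNormalized.conductor_adjoin_pair_eq (hv : IsNormalized A K v) (hζ : IsPrimitiveRoot ζ N)
    (hα : α ^ N = algebraMap A Ω a) (hLE : BreaksLE v K⟮ζ, α⟯ h) (hGE : HasBreakGE v K⟮ζ, α⟯ h) :
    conductor A K K⟮ζ, α⟯ = h :=
  have := isGalois_adjoin_pair hζ (hα.trans (IsScalarTower.algebraMap_apply A K Ω a))
  hv.conductor_eq hLE hGE

lemma IsNormalized.conductor_adjoin_pair_of_pow_eq_mul (hv : IsNormalized A K v)
    (h₁ : BreaksLE v K⟮ζ₁, x⟯ h) (h₂ : BreaksLE v K⟮ζ₂, z⟯ h') (hlt : h' < h)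
    (hGE : HasBreakGE v K⟮x⟯ h) (hζ : IsPrimitiveRoot ζ N) (hζL : ζ ∈ K⟮ζ₁, x⟯ ⊔ K⟮ζ₂, z⟯)
    (hm : m.Coprime N) (hz0 : z ≠ 0) (hx : x ^ N = algebraMap A Ω a)
    (hz : z ^ N = algebraMap A Ω b) (hα : α ^ N = algebraMap A Ω (a ^ m * b)) :
    conductor A K K⟮ζ, α⟯ = h :=
  hv.conductor_adjoin_pair_eq hζ hα
    (h₁.adjoin_pair_of_pow_eq_mul (h₂.of_le hlt.le) hv hζ hζL hx hz hα)
    (hGE.adjoin_pair_of_pow_eq_mul h₂ hlt hv hζ hm hz0 hx hz hα)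

end AdjoinPair

namespace IsDyadic

variable [IsAlgClosed Ω]

lemma exists_isUnit_sq_eq (hv : IsDyadic A K v) {b : A} (hb : 4 ∣ b - 1) :
    ∃ u, IsUnit u ∧ u ^ 2 = b := by
  have := hv.integers.isFractionRing
  have hle : v (algebraMap A Ω b - 1) ≤ 2⁻¹ ^ 2 := by
    obtain ⟨d, hd⟩ := hb
    have hd' : algebraMap A Ω b - 1 = 2 ^ 2 * algebraMap A Ω d := by
      rw [← map_one (algebraMap A Ω), ← map_sub, hd, map_mul, map_ofNat]
      norm_num
    rw [hd', map_mul, map_pow, hv.map_two]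
    exact mul_le_of_le_one_right' (hv.map_algebraMap_le_one d)
  have hbot : algebraMap A Ω b ∈ (⊥ : IntermediateField K Ω) :=
    IsScalarTower.algebraMap_apply A K Ω b ▸ algebraMap_mem ⊥ _
  obtain ⟨t, ht, htb⟩ := hv.exists_pow_two_pow_eq_of_map_sub_one_le ⊥ 1 hbot hle
  obtain ⟨w, rfl⟩ := mem_bot.mp ht
  have hwb : w ^ 2 = algebraMap A K b := (algebraMap K Ω).injective (by
    rw [map_pow, ← IsScalarTower.algebraMap_apply, ← htb, pow_one])
  obtain ⟨u, rfl⟩ := IsIntegrallyClosed.exists_algebraMap_eq_of_isIntegral_pow (R := A) two_pos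
    (hwb ▸ isIntegral_algebraMap)
  obtain rfl : u ^ 2 = b := IsFractionRing.injective A K (by rw [map_pow, hwb])
  have hu : IsUnit (u ^ 2) := isUnit_of_dvd_sub_one hv.irreducible_two.not_isUnit
    ((Dvd.intro 2 (by norm_num)).trans hb)
  exact ⟨u, (isUnit_pow_iff two_ne_zero).mp hu, rfl⟩

lemma exists_isUnit_neg_sq_eq (hv : IsDyadic A K v) {b : A} (hb : 4 ∣ b - 3) :
    ∃ u, IsUnit u ∧ -u ^ 2 = b := by
  obtain ⟨d, hd⟩ := hb
  obtain ⟨u, hu, hub⟩ := hv.exists_isUnit_sq_eq (b := -b) ⟨-d - 1, by linear_combination -hd⟩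
  exact ⟨u, hu, by rw [hub, neg_neg]⟩

variable {c d m n : ℕ} {ζ α : Ω} {u : A}

lemma exists_root_unit (hv : IsDyadic A K v) (hζ : IsPrimitiveRoot ζ (2 ^ (d + 1)))
    (hu : IsUnit u) : ∃ β : Ω, β ≠ 0 ∧ β ^ 2 ^ (d + 1) = algebraMap A Ω (u ^ 2) ∧
      BreaksLE v K⟮ζ, β⟯ d := by
  obtain ⟨β, hβ⟩ := IsAlgClosed.exists_pow_nat_eq (algebraMap A Ω u) (Nat.two_pow_pos d)
  refine ⟨β, ?_, by rw [pow_succ, pow_mul, hβ, map_pow], BreaksLE.adjoin_root_unit hv hζ hu hβ⟩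
  exact (pow_ne_zero_iff (by positivity)).mp (hβ ▸ (hu.map (algebraMap A Ω)).ne_zero)

theorem conductor_adjoin_root_odd (hv : IsDyadic A K v) (hc : 1 ≤ c)
    (hζ : IsPrimitiveRoot ζ (2 ^ c)) (hn : Odd n) (hu : IsUnit u)
    (hα : α ^ 2 ^ c = algebraMap A Ω (2 ^ n * u)) : conductor A K K⟮ζ, α⟯ = c + 1 := by
  have := hv.neZero_two
  obtain ⟨ξ, hξ⟩ := exists_isPrimitiveRoot_two_pow Ω (c + 1)
  obtain ⟨β, hβ⟩ := IsAlgClosed.exists_pow_nat_eq (algebraMap A Ω u) (Nat.two_pow_pos c)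
  obtain ⟨ρ, hρ⟩ := IsAlgClosed.exists_pow_nat_eq (2 : Ω) (Nat.two_pow_pos c)
  have hβ0 : β ≠ 0 :=
    (pow_ne_zero_iff (by positivity)).mp (hβ ▸ (hu.map (algebraMap A Ω)).ne_zero)
  exact hv.conductor_adjoin_pair_of_pow_eq_mul (BreaksLE.adjoin_root_two hv hζ hρ)
    (BreaksLE.adjoin_root_unit hv hξ hu hβ) (lt_add_one _) (HasBreakGE.adjoin_root_two hv hc hρ)
    hζ ((le_sup_left : _ ≤ _ ⊔ K⟮ξ, β⟯) (mem_adjoin_pair_left K ζ ρ))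
    (hn.coprime_two_right.pow_right c) hβ0 (hρ.trans (map_ofNat _ 2).symm) hβ hα

lemma breaksLE_adjoin_root_four_dvd (hv : IsDyadic A K v) (hζ : IsPrimitiveRoot ζ (2 ^ (d + 2)))
    (hu : IsUnit u) (hα : α ^ 2 ^ (d + 2) = algebraMap A Ω (2 ^ (4 * m) * u ^ 2)) :
    BreaksLE v K⟮ζ, α⟯ (d + 1) := by
  have := hv.neZero_two
  obtain ⟨ξ, hξ⟩ := exists_isPrimitiveRoot_two_pow Ω d
  obtain ⟨ρ, hρ⟩ := IsAlgClosed.exists_pow_nat_eq (2 : Ω) (Nat.two_pow_pos d)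
  obtain ⟨β, -, hβ, hLE⟩ := hv.exists_root_unit hζ hu
  refine BreaksLE.adjoin_pair_of_pow_eq_mul (BreaksLE.adjoin_root_two hv hξ hρ)
    (by exact_mod_cast hLE) hv.toIsNormalized hζ
    ((le_sup_right : _ ≤ K⟮ξ, ρ⟯ ⊔ _) (mem_adjoin_pair_left K ζ β)) (a := 2 ^ 4) ?_ hβ
    (by rwa [← pow_mul])
  rw [pow_add, pow_mul, hρ, map_pow, map_ofNat]
  norm_num

theorem conductor_adjoin_root_four_dvd (hv : IsDyadic A K v)
    (hζ : IsPrimitiveRoot ζ (2 ^ (d + 2))) (hu : IsUnit u)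
    (hα : α ^ 2 ^ (d + 2) = algebraMap A Ω (2 ^ (4 * m) * u ^ 2)) :
    conductor A K K⟮ζ, α⟯ = d + 1 := by
  refine hv.conductor_adjoin_pair_eq hζ hα (hv.breaksLE_adjoin_root_four_dvd hζ hu hα) ?_
  have hGE := (HasBreakGE.adjoin_primitiveRoot hv le_add_self hζ).mono hv.toIsNormalized
    (adjoin_simple_le_iff.mpr (mem_adjoin_pair_left K ζ α))
  exact_mod_cast hGE

theorem conductor_adjoin_root_neg (hv : IsDyadic A K v) (hζ : IsPrimitiveRoot ζ (2 ^ (d + 1)))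
    {a : A} (ha : a ≠ 0) {α' : Ω} (hα' : α' ^ 2 ^ (d + 1) = algebraMap A Ω a)
    (hLE : BreaksLE v K⟮ζ, α'⟯ d) (hα : α ^ 2 ^ (d + 1) = algebraMap A Ω (-a)) :
    conductor A K K⟮ζ, α⟯ = d + 1 := by
  have := hv.neZero_two
  have := hv.integers.isFractionRing
  have hα'0 : α' ≠ 0 := by
    rintro rfl
    rw [zero_pow (by positivity), IsScalarTower.algebraMap_apply A K Ω, eq_comm, map_eq_zero,
      IsFractionRing.to_map_eq_zero_iff] at hα'
    exact ha hα'
  obtain ⟨ξ, hξ⟩ := exists_isPrimitiveRoot_two_pow Ω (d + 2)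
  have hξ1 : ξ ^ 2 ^ (d + 1) = algebraMap A Ω (-1) := by
    rw [isPrimitiveRoot_two_pow_succ_iff.mp hξ, map_neg, map_one]
  have hξLE := BreaksLE.adjoin_root_unit hv hξ isUnit_one.neg hξ1
  have hξGE := HasBreakGE.adjoin_primitiveRoot hv le_add_self hξ
  rw [Nat.cast_add, Nat.cast_one] at hξLE hξGE
  exact hv.conductor_adjoin_pair_of_pow_eq_mul hξLE hLE (lt_add_one _) hξGE hζ
    ((le_sup_right : _ ≤ K⟮ξ, ξ⟯ ⊔ _) (mem_adjoin_pair_left K ζ α')) (Nat.coprime_one_left _)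
    hα'0 hξ1 hα' (by rwa [pow_one, neg_one_mul])

theorem conductor_adjoin_root_two_mul_odd (hv : IsDyadic A K v) (hd : 1 ≤ d)
    (hζ : IsPrimitiveRoot ζ (2 ^ (d + 1))) (hm : Odd m) (hu : IsUnit u)
    (hα : α ^ 2 ^ (d + 1) = algebraMap A Ω (2 ^ (2 * m) * u ^ 2)) :
    conductor A K K⟮ζ, α⟯ = d + 1 := by
  have := hv.neZero_two
  obtain ⟨ξ, hξ⟩ := exists_isPrimitiveRoot_two_pow Ω d
  obtain ⟨ρ, hρ⟩ := IsAlgClosed.exists_pow_nat_eq (2 : Ω) (Nat.two_pow_pos d)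
  obtain ⟨β, hβ0, hβ, hLE⟩ := hv.exists_root_unit hζ hu
  refine hv.conductor_adjoin_pair_of_pow_eq_mul (BreaksLE.adjoin_root_two hv hξ hρ) hLE
    (lt_add_one _) (HasBreakGE.adjoin_root_two hv hd hρ) hζ
    ((le_sup_right : _ ≤ K⟮ξ, ρ⟯ ⊔ _) (mem_adjoin_pair_left K ζ β))
    (hm.coprime_two_right.pow_right _) hβ0 (a := 2 ^ 2) ?_ hβ (by rwa [← pow_mul])
  rw [pow_succ, pow_mul, hρ, map_pow, map_ofNat]

theorem conductor_adjoin_root_two_mul_odd_neg (hv : IsDyadic A K v) (hd : 1 ≤ d)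
    (hζ : IsPrimitiveRoot ζ (2 ^ (d + 2))) (hm : Odd m) (hu : IsUnit u)
    (hα : α ^ 2 ^ (d + 2) = algebraMap A Ω (-(2 ^ (2 * m) * u ^ 2))) :
    conductor A K K⟮ζ, α⟯ = d + 3 / 2 := by
  obtain ⟨i, hi⟩ := IsAlgClosed.exists_pow_nat_eq (-1 : Ω) two_pos
  obtain ⟨x, hx⟩ := IsAlgClosed.exists_pow_nat_eq (1 + i) (Nat.two_pow_pos d)
  obtain ⟨β, hβ0, hβ, hLE⟩ := hv.exists_root_unit hζ hu
  refine hv.conductor_adjoin_pair_of_pow_eq_mul (BreaksLE.adjoin_root_one_add hv hζ hi hx) hLE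
    (by push_cast; linarith) (HasBreakGE.adjoin_root_one_add hv hd hi hx) hζ
    ((le_sup_left : _ ≤ _ ⊔ K⟮ζ, β⟯) (mem_adjoin_pair_left K ζ x))
    (hm.coprime_two_right.pow_right _) hβ0 (a := -4) ?_ hβ (by rwa [← neg_two_pow_two_mul hm])
  rw [pow_add, pow_mul, hx, show 2 ^ 2 = 4 by rfl, one_add_pow_four hi, map_neg, map_ofNat]

theorem conductor_adjoin_fourth_root_two_mul_odd_neg (hv : IsDyadic A K v)
    (hζ : IsPrimitiveRoot ζ (2 ^ 2)) (hm : Odd m) (hu : IsUnit u)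
    (hα : α ^ 2 ^ 2 = algebraMap A Ω (-(2 ^ (2 * m) * u ^ 2))) :
    conductor A K K⟮ζ, α⟯ = 1 := by
  have := hv.neZero_two
  obtain ⟨β, -, hβ, hLE⟩ := hv.exists_root_unit hζ hu
  have hi : ζ ^ 2 = -1 := isPrimitiveRoot_two_pow_succ_iff.mp hζ
  have hζβ := mem_adjoin_pair_left K ζ β
  have hle : K⟮ζ, α⟯ ≤ K⟮ζ, β⟯ := by
    refine adjoin_pair_le_of_pow_eq hζ.pow_eq_one hζ hζβ
      (mul_mem (pow_mem (add_mem (one_mem _) hζβ) m) (mem_adjoin_pair_right K ζ β)) ?_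
    rw [hα, neg_two_pow_two_mul hm, mul_pow, hβ, pow_right_comm, show 2 ^ 2 = 4 by rfl,
      one_add_pow_four hi, map_mul, map_pow, map_neg, map_ofNat]
  have hGE := HasBreakGE.adjoin_primitiveRoot hv le_rfl hζ
  rw [Nat.cast_one] at hLE hGE
  exact hv.conductor_adjoin_pair_eq hζ hα (hLE.mono hv.toIsNormalized hle) (hGE.mono
    hv.toIsNormalized (adjoin_simple_le_iff.mpr (mem_adjoin_pair_left K ζ α)))

theorem conductor_adjoin_root_even_of_four_dvd_sub_one (hv : IsDyadic A K v) (hc : 1 ≤ c)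
    (hζ : IsPrimitiveRoot ζ (2 ^ c)) (hn : Even n) {b : A} (hb : 4 ∣ b - 1)
    (hα : α ^ 2 ^ c = algebraMap A Ω (2 ^ n * b)) :
    (c = 1 → K⟮ζ, α⟯ = ⊥) ∧
    (4 ∣ n → 1 < c → conductor A K K⟮ζ, α⟯ = c - 1) ∧
    (¬4 ∣ n → 1 < c → conductor A K K⟮ζ, α⟯ = c) := by
  obtain ⟨u, hu, rfl⟩ := hv.exists_isUnit_sq_eq hb
  obtain ⟨m, rfl⟩ := even_iff_two_dvd.mp hn
  refine ⟨?_, ?_, ?_⟩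
  · rintro rfl
    exact adjoin_pair_eq_bot (by simpa using hζ) (a := 2 ^ m * u)
      (by rwa [mul_pow, pow_right_comm, ← pow_mul])
  · rintro ⟨l, hl⟩ hc'
    obtain ⟨d, rfl⟩ := Nat.exists_eq_add_of_le' hc'
    rw [hv.conductor_adjoin_root_four_dvd hζ hu (hl ▸ hα)]
    push_cast
    ring
  · intro h4 hc'
    obtain ⟨d, rfl⟩ := Nat.exists_eq_add_of_le' hc
    rw [hv.conductor_adjoin_root_two_mul_odd (by lia) hζ (by grind) hu hα, Nat.cast_add_one]

theorem conductor_adjoin_root_even_of_four_dvd_sub_three (hv : IsDyadic A K v) (hc : 1 ≤ c)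
    (hζ : IsPrimitiveRoot ζ (2 ^ c)) (hn : Even n) {b : A} (hb : 4 ∣ b - 3)
    (hα : α ^ 2 ^ c = algebraMap A Ω (2 ^ n * b)) :
    (c = 1 → conductor A K K⟮ζ, α⟯ = 1) ∧
    (4 ∣ n → 1 < c → conductor A K K⟮ζ, α⟯ = c) ∧
    (¬4 ∣ n → c = 2 → conductor A K K⟮ζ, α⟯ = 1) ∧
    (¬4 ∣ n → 2 < c → conductor A K K⟮ζ, α⟯ = c - 1 / 2) := by
  obtain ⟨u, hu, rfl⟩ := hv.exists_isUnit_neg_sq_eq hb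
  rw [mul_neg] at hα
  have ha : 2 ^ n * u ^ 2 ≠ 0 :=
    mul_ne_zero (pow_ne_zero n hv.irreducible_two.ne_zero) (pow_ne_zero 2 hu.ne_zero)
  obtain ⟨α', hα'⟩ := IsAlgClosed.exists_pow_nat_eq (algebraMap A Ω (2 ^ n * u ^ 2))
    (Nat.two_pow_pos c)
  obtain ⟨m, rfl⟩ := even_iff_two_dvd.mp hn
  refine ⟨?_, ?_, ?_, ?_⟩
  · rintro rfl
    have hbot : K⟮ζ, α'⟯ = ⊥ := adjoin_pair_eq_bot (by simpa using hζ) (a := 2 ^ m * u)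
      (by rwa [mul_pow, pow_right_comm, ← pow_mul])
    rw [hv.conductor_adjoin_root_neg (d := 0) hζ ha hα' (BreaksLE.of_le_bot v hbot.le _) hα]
    norm_num
  · rintro ⟨l, hl⟩ hc'
    obtain ⟨d, rfl⟩ := Nat.exists_eq_add_of_le' hc'
    have hLE := hv.breaksLE_adjoin_root_four_dvd hζ hu (hl ▸ hα')
    rw [hv.conductor_adjoin_root_neg (d := d + 1) hζ ha hα' (by exact_mod_cast hLE) hα]
    push_cast
    ring
  · rintro h4 rfl
    exact hv.conductor_adjoin_fourth_root_two_mul_odd_neg hζ (by grind) hu hα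
  · intro h4 hc'
    obtain ⟨d, rfl⟩ := Nat.exists_eq_add_of_le' hc'
    rw [hv.conductor_adjoin_root_two_mul_odd_neg (d := d + 1) le_add_self hζ (by grind) hu hα]
    push_cast
    ring

end IsDyadic

end Kummer

/-! ### Complete discrete valuation rings and Witt vectors -/

section Complete

open IsDedekindDomain

variable (A K : Type*) [CommRing A] [IsDomain A] [IsDiscreteValuationRing A] [Field K]
  [Algebra A K] [IsFractionRing A K]

/-- The absolute value on the fraction field of a discrete valuation ring for which the
uniformizers have absolute value `1 / 2`. -/
noncomputable def uniformizerAbv : AbsoluteValue K ℝ :=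
  (IsDiscreteValuationRing.maximalIdeal A).adicAbv (b := 2) one_lt_two

variable {A K}

lemma toNNReal_exp {e : ℝ≥0} (he : e ≠ 0) (n : ℤ) :
    WithZeroMulInt.toNNReal he (WithZero.exp n) = e ^ n :=
  WithZeroMulInt.toNNReal_neg_apply he WithZero.exp_ne_zero

lemma uniformizerAbv_le_one_iff {x : K} :
    uniformizerAbv A K x ≤ 1 ↔ ∃ a : A, algebraMap A K a = x := by
  refine ⟨fun h ↦ IsDiscreteValuationRing.exists_lift_of_le_one
    ((WithZeroMulInt.toNNReal_le_one_iff one_lt_two).mp h), ?_⟩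
  rintro ⟨a, rfl⟩
  exact HeightOneSpectrum.adicAbv_coe_le_one ..

lemma uniformizerAbv_irreducible {ϖ : A} (hϖ : Irreducible ϖ) :
    uniformizerAbv A K (algebraMap A K ϖ) = 2⁻¹ := by
  have hval := (IsDiscreteValuationRing.maximalIdeal A).intValuation_singleton hϖ.ne_zero
    hϖ.maximalIdeal_eq
  change ((WithZeroMulInt.toNNReal two_ne_zero _ : ℝ≥0) : ℝ) = _
  rw [HeightOneSpectrum.valuation_of_algebraMap, hval, toNNReal_exp]
  simp

lemma uniformizerAbv_le_pow_iff {a : A} {n : ℕ} :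
    uniformizerAbv A K (algebraMap A K a) ≤ 2⁻¹ ^ n ↔ a ∈ maximalIdeal A ^ n := by
  have hpow : (2⁻¹ : ℝ) ^ n =
      (WithZeroMulInt.toNNReal two_ne_zero (WithZero.exp (-n : ℤ)) : ℝ≥0) := by
    simp [toNNReal_exp]
  change ((WithZeroMulInt.toNNReal two_ne_zero _ : ℝ≥0) : ℝ) ≤ _ ↔ _
  rw [hpow, NNReal.coe_le_coe, (WithZeroMulInt.toNNReal_strictMono one_lt_two).le_iff_le,
    HeightOneSpectrum.valuation_of_algebraMap, HeightOneSpectrum.intValuation_le_pow_iff_mem]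
  rfl

variable [IsPrecomplete (maximalIdeal A) A]

variable (A K) in
lemma completeSpace_uniformizerAbv :
    @CompleteSpace K (uniformizerAbv A K).toNormedField.toMetricSpace.toUniformSpace := by
  let := (uniformizerAbv A K).toNormedField
  refine Metric.complete_of_convergent_controlled_sequences (fun n ↦ (2⁻¹ : ℝ) ^ n)
    (fun n ↦ by positivity) fun u hu ↦ ?_
  have hdist (x y : K) : dist x y = uniformizerAbv A K (x - y) := dist_eq_norm x y
  have hlift (n : ℕ) : ∃ a : A, algebraMap A K a = u n - u 0 := by
    rw [← uniformizerAbv_le_one_iff, ← hdist]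
    simpa using (hu 0 n 0 n.zero_le le_rfl).le
  choose a ha using hlift
  have hcauchy {m n : ℕ} (h : m ≤ n) : a m ≡ a n [SMOD maximalIdeal A ^ m • (⊤ : Ideal A)] := by
    rw [SModEq.sub_mem, smul_eq_mul, Ideal.mul_top, ← uniformizerAbv_le_pow_iff (K := K), map_sub,
      ha, ha, sub_sub_sub_cancel_right, ← hdist]
    exact (hu m m n le_rfl h).le
  obtain ⟨l, hl⟩ := IsPrecomplete.prec ‹_› hcauchy
  refine ⟨u 0 + algebraMap A K l, tendsto_iff_dist_tendsto_zero.mpr <|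
    squeeze_zero (fun _ ↦ dist_nonneg) (fun n ↦ ?_)
      (tendsto_pow_atTop_nhds_zero_of_lt_one (r := (2⁻¹ : ℝ)) (by norm_num) (by norm_num))⟩
  have hlim := hl n
  rwa [SModEq.sub_mem, smul_eq_mul, Ideal.mul_top, ← uniformizerAbv_le_pow_iff (K := K), map_sub,
    ha, sub_sub, ← hdist] at hlim

variable (A K) in
lemma exists_isNormalized (Ω : Type*) [Field Ω] [Algebra K Ω] [Algebra.IsAlgebraic K Ω] :
    ∃ v : Valuation Ω ℝ≥0, IsNormalized A K v := by
  obtain ⟨ϖ, hϖ⟩ := IsDiscreteValuationRing.exists_irreducible A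
  let := (uniformizerAbv A K).toNormedField
  let : NontriviallyNormedField K := .ofNormNeOne ⟨algebraMap A K ϖ,
    by simpa using hϖ.ne_zero, (uniformizerAbv_irreducible hϖ).trans_ne (by norm_num)⟩
  have : IsUltrametricDist K := IsUltrametricDist.isUltrametricDist_of_isNonarchimedean_norm
    (HeightOneSpectrum.isNonarchimedean_adicAbv _ one_lt_two)
  have : CompleteSpace K := completeSpace_uniformizerAbv A K
  let N := spectralMulAlgNorm K Ω
  let v : Valuation Ω ℝ≥0 :=
    { toFun x := ⟨N x, apply_nonneg N x⟩
      map_zero' := Subtype.ext (map_zero N)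
      map_one' := Subtype.ext (map_one N)
      map_mul' x y := Subtype.ext (map_mul N x y)
      map_add_le_max' x y := by
        exact_mod_cast isNonarchimedean_spectralNorm (K := K) (L := Ω) x y }
  have hv (x : K) : (v (algebraMap K Ω x) : ℝ) = uniformizerAbv A K x := spectralNorm_extends x
  have hle (x : K) : v (algebraMap K Ω x) ≤ 1 ↔ ∃ a : A, algebraMap A K a = x := by
    rw [← uniformizerAbv_le_one_iff, ← hv]
    norm_cast
  refine ⟨v, fun σ x ↦ Subtype.ext (spectralNorm_eq_of_equiv σ x).symm,
    ⟨IsFractionRing.injective A K, fun a ↦ (hle _).mpr ⟨a, rfl⟩, fun x h ↦ (hle _).mp h⟩,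
    fun h ↦ NNReal.coe_injective ?_⟩
  rw [hv, uniformizerAbv_irreducible h]
  simp

end Complete

lemma charZero_of_irreducible_natCast {R : Type*} [CommRing R] [IsDomain R] {p : ℕ} (hp : p.Prime)
    (hirr : Irreducible (p : R)) : CharZero R := by
  obtain ⟨q, hq⟩ := CharP.exists R
  rcases CharP.char_is_prime_or_zero R q with hq' | rfl
  · have hne : p ≠ q := by
      rintro rfl
      exact hirr.ne_zero (CharP.cast_eq_zero R p)
    have hcop : IsCoprime (p : R) (q : R) := by
      simpa using ((Nat.coprime_primes hp hq').mpr hne).isCoprime.map (Int.castRingHom R)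
    rw [CharP.cast_eq_zero R q, isCoprime_zero_right] at hcop
    exact (hirr.not_isUnit hcop).elim
  · exact CharP.charP_to_charZero R

section Witt

variable {p : ℕ} [Fact p.Prime] (k : Type*) [Field k] [CharP k p]

instance : CharZero (WittVector p k) :=
  charZero_of_irreducible_natCast Fact.out (WittVector.irreducible p)

variable [PerfectRing k p]

lemma ker_constantCoeff_eq_maximalIdeal :
    RingHom.ker (WittVector.constantCoeff (p := p) (R := k)) = maximalIdeal (WittVector p k) :=
  ker_eq_maximalIdeal _ (WittVector.constantCoeff_surjective p)

instance : IsPrecomplete (maximalIdeal (WittVector p k)) (WittVector p k) := by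
  rw [← ker_constantCoeff_eq_maximalIdeal, WittVector.ker_constantCoeff]
  infer_instance

instance [IsAlgClosed k] : IsAlgClosed (ResidueField (WittVector p k)) :=
  .of_ringEquiv k _ <|
    ((Ideal.quotEquivOfEq (ker_constantCoeff_eq_maximalIdeal k)).symm.trans
      (RingHom.quotientKerEquivOfSurjective (WittVector.constantCoeff_surjective p))).symm

end Witt

lemma exists_isDyadic_wittVector (k : Type*) [Field k] [CharP k 2] [PerfectRing k 2] :
    ∃ v : Valuation (AlgebraicClosure (WittField k)) ℝ≥0,
      IsDyadic (WittVector 2 k) (WittField k) v := by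
  obtain ⟨v, hv⟩ := exists_isNormalized (WittVector 2 k) (WittField k)
    (AlgebraicClosure (WittField k))
  exact ⟨v, hv, by simpa using WittVector.irreducible 2 (k := k)⟩

end Ramification

open Ramification IntermediateField in
theorem theorem5p1_general {A K Ω : Type*} [CommRing A] [IsDomain A] [IsDiscreteValuationRing A]
    [IsAlgClosed (IsLocalRing.ResidueField A)] [Field K] [Field Ω] [IsAlgClosed Ω] [Algebra A K]
    [Algebra K Ω] [IsGalois K Ω] [Algebra A Ω] [IsScalarTower A K Ω] {v : Valuation Ω NNReal}
    (hv : IsDyadic A K v) {c n : ℕ} (hc : 1 ≤ c) {b : A} (hb : 2 ∣ b - 1) {ζ α : Ω}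
    (hζ : IsPrimitiveRoot ζ (2 ^ c)) (hα : α ^ 2 ^ c = algebraMap A Ω (2 ^ n * b)) :
    FiniteDimensional K K⟮ζ, α⟯ ∧ IsGalois K K⟮ζ, α⟯ ∧
    (Odd n → conductor A K K⟮ζ, α⟯ = c + 1) ∧
    (Even n →
      (c = 1 → 4 ∣ b - 1 → K⟮ζ, α⟯ = ⊥) ∧
      (c = 1 → 4 ∣ b - 3 → conductor A K K⟮ζ, α⟯ = 1) ∧
      (4 ∣ n → 1 < c → 4 ∣ b - 1 → conductor A K K⟮ζ, α⟯ = c - 1) ∧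
      (4 ∣ n → 1 < c → 4 ∣ b - 3 → conductor A K K⟮ζ, α⟯ = c) ∧
      (¬4 ∣ n → 1 < c → 4 ∣ b - 1 → conductor A K K⟮ζ, α⟯ = c) ∧
      (¬4 ∣ n → c = 2 → 4 ∣ b - 3 → conductor A K K⟮ζ, α⟯ = 1) ∧
      (¬4 ∣ n → 2 < c → 4 ∣ b - 3 → conductor A K K⟮ζ, α⟯ = c - 1 / 2)) := by
  refine ⟨inferInstance,
    isGalois_adjoin_pair hζ (hα.trans (IsScalarTower.algebraMap_apply A K Ω _)),
    fun hn ↦ hv.conductor_adjoin_root_odd hc hζ hn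
      (isUnit_of_dvd_sub_one hv.irreducible_two.not_isUnit hb) hα, fun hn ↦ ?_⟩
  have hone (h : 4 ∣ b - 1) := hv.conductor_adjoin_root_even_of_four_dvd_sub_one hc hζ hn h hα
  have hthree (h : 4 ∣ b - 3) := hv.conductor_adjoin_root_even_of_four_dvd_sub_three hc hζ hn h hα
  exact ⟨fun h1 hb ↦ (hone hb).1 h1, fun h1 hb ↦ (hthree hb).1 h1,
    fun h4 h1 hb ↦ (hone hb).2.1 h4 h1, fun h4 h1 hb ↦ (hthree hb).2.1 h4 h1,
    fun h4 h1 hb ↦ (hone hb).2.2 h4 h1, fun h4 h2 hb ↦ (hthree hb).2.2.1 h4 h2,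
    fun h4 h2 hb ↦ (hthree hb).2.2.2 h4 h2⟩

theorem theorem5p1 (k : Type*) [Field k] [IsAlgClosed k] [CharP k 2]
    (c n : ℕ) (hc : 1 ≤ c) (hn : n < 2 ^ c)
    (b : WittVector 2 k) (hb : (2 : WittVector 2 k) ∣ b - 1)
    (ζ α : AlgebraicClosure (Ramification.WittField k)) (hζ : IsPrimitiveRoot ζ (2 ^ c))
    (hα : α ^ (2 ^ c) = algebraMap (WittVector 2 k) (AlgebraicClosure (Ramification.WittField k)) (2 ^ n * b))
    (K : IntermediateField (Ramification.WittField k) (AlgebraicClosure (Ramification.WittField k)))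
    (hK : K = IntermediateField.adjoin (Ramification.WittField k) {ζ, α}) :
    FiniteDimensional (Ramification.WittField k) K ∧ IsGalois (Ramification.WittField k) K ∧
    (Odd n → Ramification.conductor (WittVector 2 k) (Ramification.WittField k) K = c + 1) ∧
    (Even n →
      (c = 1 → 4 ∣ b - 1 → K = ⊥) ∧
      (c = 1 → 4 ∣ b - 3 → Ramification.conductor (WittVector 2 k) (Ramification.WittField k) K = 1) ∧
      (4 ∣ n → 1 < c → 4 ∣ b - 1 → Ramification.conductor (WittVector 2 k) (Ramification.WittField k) K = c - 1) ∧
      (4 ∣ n → 1 < c → 4 ∣ b - 3 → Ramification.conductor (WittVector 2 k) (Ramification.WittField k) K = c) ∧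
      (¬ 4 ∣ n → 1 < c → 4 ∣ b - 1 → Ramification.conductor (WittVector 2 k) (Ramification.WittField k) K = c) ∧
      (¬ 4 ∣ n → c = 2 → 4 ∣ b - 3 → Ramification.conductor (WittVector 2 k) (Ramification.WittField k) K = 1) ∧
      (¬ 4 ∣ n → 2 < c → 4 ∣ b - 3 →
        Ramification.conductor (WittVector 2 k) (Ramification.WittField k) K = c - 1 / 2)) := by
  obtain ⟨v, hv⟩ := Ramification.exists_isDyadic_wittVector k
  subst hK
  exact theorem5p1_general hv hc hb hζ hα
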